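/- Let $k,d\ge 1$ and let $W=(W_{ni})_{n\ge 1,\,1\le i\le n}$ be local probability weights on $\mathbb{R}^k$: each $W_{ni}(x)=W_{ni}(x;x_1,\dots,x_n)$ is a measurable function of $(x,x_1,\dots,x_n)\in(\mathbb{R}^k)^{n+1}$, $W_{ni}(x)\ge 0$ and $\sum_{i=1}^n W_{ni}(x)=1$. Let $\mu$ be a Borel probability measure on $\mathbb{R}^k$. For $X,X_1,X_2,\dots$ independent with law $\mu$, and $W_{ni}(X)=W_{ni}(X;X_1,\dots,X_n)$, consider Stone's conditions: i) there is $C>0$ such that $\mathbb{E}\big[\sum_{i=1}^n W_{ni}(X)g(X_i)\big]\le C\,\mathbb{E}[g(X)]$ for all $n\ge 1$ and all measurable $g:\mathbb{R}^k\to[0,\infty)$ with $\mathbb{E}[g(X)]<\infty$; ii) for all $\varepsilon>0$, $\sum_{i=1}^n W_{ni}(X)\mathbf{1}_{\{\|X_i-X\|>\varepsilon\}}\to 0$ in probability as $n\to\infty$; iii) $\max_{1\le i\le n}W_{ni}(X)\to 0$ in probability as $n\to\infty$. For a law $P$ on $\mathbb{R}^k\times\mathbb{R}^d$ with first margin $\mu$,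 let $(X,Y),(X_1,Y_1),(X_2,Y_2),\dots$ be independent with law $P$, let $F_x$ be the conditional distribution of $Y$ given $X=x$, and let $\hat F_{n,x}=\sum_{i=1}^n W_{ni}(x;X_1,\dots,X_n)\,\delta_{Y_i}$. For $p\ge 1$ let $\mathcal{W}_p(Q_1,Q_2)=\inf_\pi\big(\int\|y_1-y_2\|^p\,\pi(dy_1\,dy_2)\big)^{1/p}$, the infimum being over all measures $\pi$ on $\mathbb{R}^d\times\mathbb{R}^d$ with margins $Q_1$ and $Q_2$. If $W$ satisfies i)–iii), then for every real $p\ge 1$ and every law $P$ of $(X,Y)$ with first margin $\mu$ and $\mathbb{E}[\|Y\|^p]<\infty$, $$\mathbb{E}\big[\mathcal{W}_p^p(\hat F_{n,X},F_X)\big]\longrightarrow 0\quad\text{as } n\to\infty. \qquad (*)$$ Conversely, if for some real $p\ge 1$ the convergence $(*)$ holds for every law $P$ of $(X,Y)$ with first margin $\mu$ and $\mathbb{E}[\|Y\|^p]<\infty$, then $W$ satisfies i)–iii). -/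

import Mathlib

open MeasureTheory ProbabilityTheory Filter Topology
open scoped ENNReal NNReal

/-- The Euclidean space `ℝ^m`. -/
abbrev Euc (m : ℕ) : Type := EuclideanSpace ℝ (Fin m)

/-- A family of local weights for covariates in `ℝ^k`: `W n i x xs` is the weight
`W_{ni}(x) = W_{ni}(x; X_1, …, X_n)` at the point `x`, for the covariates `xs = (X_1, …, X_n)`. -/
abbrev LocalWeights (k : ℕ) : Type := (n : ℕ) → Fin n → Euc k → (Fin n → Euc k) → ℝ

/-- Probability weights: for every sample size `n ≥ 1` the weights are (jointly) measurable
functions of `x` and `X_1, …, X_n`, nonnegative, and they sum to one. -/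
structure IsProbabilityWeights {k : ℕ} (W : LocalWeights k) : Prop where
  measurable : ∀ n : ℕ, 1 ≤ n → ∀ i : Fin n,
    Measurable (fun z : Euc k × (Fin n → Euc k) => W n i z.1 z.2)
  nonneg : ∀ n : ℕ, 1 ≤ n → ∀ (i : Fin n) (x : Euc k) (xs : Fin n → Euc k), 0 ≤ W n i x xs
  sum_eq_one : ∀ n : ℕ, 1 ≤ n → ∀ (x : Euc k) (xs : Fin n → Euc k), ∑ i, W n i x xs = 1

/-- The joint law of `(Z, (Z_1, …, Z_n))`, where `Z, Z_1, …, Z_n` are independent with law `P`.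
The first component is the new observation, the second one is the sample. -/
noncomputable def sampleLaw {α : Type*} [MeasurableSpace α] (P : Measure α) (n : ℕ) :
    Measure (α × (Fin n → α)) :=
  P.prod (Measure.pi fun _ : Fin n => P)

/-- Stone's conditions i), ii), iii) on the weights `W`, when the covariates have law `μ`.
Here `z.1` is `X` and `z.2 i` is `X_i`. -/
structure StoneConditions {k : ℕ} (μ : Measure (Euc k)) (W : LocalWeights k) : Prop where
  /-- i) there is `C > 0` with `E[∑ W_{ni}(X) g(X_i)] ≤ C E[g(X)]` for all `n ≥ 1` and all
  measurable `g ≥ 0` such that `E[g(X)] < ∞`. -/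
  bounded : ∃ C : ℝ≥0, 0 < C ∧ ∀ n : ℕ, 1 ≤ n → ∀ g : Euc k → ℝ≥0, Measurable g →
    ∫⁻ x, (g x : ℝ≥0∞) ∂μ < ∞ →
    ∫⁻ z, ∑ i, ENNReal.ofReal (W n i z.1 z.2) * (g (z.2 i) : ℝ≥0∞) ∂(sampleLaw μ n)
      ≤ (C : ℝ≥0∞) * ∫⁻ x, (g x : ℝ≥0∞) ∂μ
  /-- ii) for all `ε > 0`, `∑ W_{ni}(X) 1_{‖X_i - X‖ > ε} → 0` in probability. -/
  local_mass : ∀ ε : ℝ, 0 < ε → ∀ η : ℝ, 0 < η →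
    Tendsto (fun n : ℕ => sampleLaw μ n
      {z | η < ∑ i, W n i z.1 z.2 * Set.indicator {x : Euc k | ε < ‖x - z.1‖} 1 (z.2 i)})
      atTop (𝓝 0)
  /-- iii) `max_i W_{ni}(X) → 0` in probability. -/
  max_weight : ∀ η : ℝ, 0 < η →
    Tendsto (fun n : ℕ => sampleLaw μ n {z | η < ⨆ i : Fin n, W n i z.1 z.2}) atTop (𝓝 0)

/-- The Wasserstein distance of order `p` between two measures on `ℝ^d`, with values in `[0, ∞]`:
the infimum of `(∫ ‖y₁ - y₂‖^p dπ)^{1/p}` over the measures `π` with margins `Q₁` and `Q₂`. -/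
noncomputable def wassersteinDist {d : ℕ} (p : ℝ) (Q₁ Q₂ : Measure (Euc d)) : ℝ≥0∞ :=
  ⨅ (π : Measure (Euc d × Euc d)) (_ : π.fst = Q₁ ∧ π.snd = Q₂),
    (∫⁻ y, ‖y.1 - y.2‖ₑ ^ p ∂π) ^ (1 / p)

/-- The weighted empirical distribution `∑ W_{ni}(x) δ_{Y_i}` of the sample
`s i = (X_i, Y_i)`, `i = 1, …, n`, at the point `x`. -/
noncomputable def weightedEmpirical {k d : ℕ} (W : LocalWeights k) {n : ℕ}
    (s : Fin n → Euc k × Euc d) (x : Euc k) : Measure (Euc d) :=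
  ∑ i, ENNReal.ofReal (W n i x fun j => (s j).1) • Measure.dirac (s i).2

/-- The expected error `E[W_p^p(F̂_{n,X}, F_X)]`, where `(X, Y), (X_1, Y_1), …, (X_n, Y_n)` are
independent with law `P` and `F_x` is the conditional distribution of `Y` given `X = x`. -/
noncomputable def expectedError {k d : ℕ} (W : LocalWeights k) (p : ℝ)
    (P : Measure (Euc k × Euc d)) [IsFiniteMeasure P] (n : ℕ) : ℝ≥0∞ :=
  ∫⁻ z, wassersteinDist p (weightedEmpirical W z.2 z.1.1) (P.condKernel z.1.1) ^ p
    ∂(sampleLaw P n)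

/-! Sufficiency. Cover `ℝ^d`, up to a set `D` carrying little of the `p`-th moment of `Y`, by
finitely many disjoint cells `B j` of small diameter. Leaving the common mass of each cell inside
the cell and transporting the rest by a product coupling bounds `W_p^p` by a small constant, plus a
multiple of the sum of `|F̂(B j) - F_X(B j)|`, plus the moments of both measures over `D`
(`exists_coupling_of_partition`). By i), the expected moment of `F̂` over `D` is at most `C` times
that of `Y`. On a fixed cell `B`, put `m(x) = F_x(B)`. Then `F̂(B) - F_X(B)` is the sum of `∑ W_i
(1_B(Y_i) - m(X_i))` and `∑ W_i (m(X_i) - m(X))`. The first sum has conditionally centered,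
independent terms, so its second moment is at most `E[max W_i]`, which vanishes by iii). The second
vanishes by ii) when `m` is uniformly continuous, and in general by `L¹` approximation, whose error
i) controls.

Necessity comes from testing consistency on special laws. If `Y = g(X)`, then `F_X` is a Dirac mass
and the error dominates `∑ W_i ‖g(X_i) - g(X)‖^p`. Indicators of small cells as `g` give ii).
Unbounded `g` show that the means of local averages of each integrable function are bounded in `n`,
and summing a sequence of supposed counterexamples upgrades this to the uniform constant of i). If
`Y` is independent of `X` and takes two values with equal probability, the variance of the averaged
response is a multiple of `∑ W_i²`, which dominates `(max W_i)²` and gives iii). -/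

theorem tendsto_zero_of_forall_eventually_le_add {f : ℕ → ℝ≥0∞}
    (h : ∀ ε : ℝ≥0∞, 0 < ε → ∃ g : ℕ → ℝ≥0∞, Tendsto g atTop (𝓝 0) ∧
      ∀ᶠ n in atTop, f n ≤ ε + g n) :
    Tendsto f atTop (𝓝 0) := by
  rw [ENNReal.tendsto_nhds_zero]
  intro ε hε
  obtain ⟨g, hg, hfg⟩ := h (ε / 2) (ENNReal.half_pos hε.ne')
  filter_upwards [hfg, ENNReal.tendsto_nhds_zero.1 hg (ε / 2) (ENNReal.half_pos hε.ne')]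
    with n h1 h2
  calc f n ≤ ε / 2 + g n := h1
    _ ≤ ε / 2 + ε / 2 := by gcongr
    _ = ε := ENNReal.add_halves ε

/-! ### Independent samples and orthogonality of centered responses -/

section SampleLaw

variable {α β : Type*} [MeasurableSpace α] [MeasurableSpace β]

instance isProbabilityMeasure_sampleLaw (P : Measure α) [IsProbabilityMeasure P] (n : ℕ) :
    IsProbabilityMeasure (sampleLaw P n) := by
  unfold sampleLaw; infer_instance

theorem measurePreserving_sampleLaw {P : Measure α} {Q : Measure β} [IsProbabilityMeasure P]
    [IsProbabilityMeasure Q] {f : α → β} (hf : MeasurePreserving f P Q) (n : ℕ) :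
    MeasurePreserving (fun z : α × (Fin n → α) => (f z.1, fun i => f (z.2 i)))
      (sampleLaw P n) (sampleLaw Q n) :=
  hf.prod (measurePreserving_pi _ _ fun _ => hf)

theorem measurePreserving_fst_sampleLaw (P : Measure α) [IsProbabilityMeasure P] (n : ℕ) :
    MeasurePreserving (fun z : α × (Fin n → α) => z.1) (sampleLaw P n) P :=
  measurePreserving_fst

theorem measurePreserving_eval_sampleLaw (P : Measure α) [IsProbabilityMeasure P] {n : ℕ}
    (i : Fin n) :
    MeasurePreserving (fun z : α × (Fin n → α) => z.2 i) (sampleLaw P n) P :=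
  (measurePreserving_eval (fun _ : Fin n => P) i).comp measurePreserving_snd

theorem integrable_of_measurable_of_abs_le {μ : Measure α} [IsFiniteMeasure μ] {f : α → ℝ}
    (hf : Measurable f) {c : ℝ} (hc : ∀ x, |f x| ≤ c) : Integrable f μ :=
  Integrable.of_bound hf.aestronglyMeasurable c (Eventually.of_forall hc)

/-- If `h (X_i, Y_i)` has conditional mean zero given `X_i`, it is orthogonal to every function of
the sample which depends on the `i`-th observation through `X_i` only. -/
theorem integral_pi_mul_eq_zero {μ : Measure α} [IsProbabilityMeasure μ] {κ : Kernel α β}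
    [IsMarkovKernel κ] {n : ℕ} (i : Fin n) {ψ : (Fin n → α × β) → ℝ} (hψ : Measurable ψ) {c : ℝ}
    (hψc : ∀ s, |ψ s| ≤ c)
    (hψi : ∀ s y, ψ (Function.update s i ((s i).1, y)) = ψ s)
    {h : α × β → ℝ} (hh : Measurable h) {C : ℝ} (hhC : ∀ z, |h z| ≤ C)
    (h0 : ∀ x, ∫ y, h (x, y) ∂(κ x) = 0) :
    ∫ s, ψ s * h (s i) ∂(Measure.pi fun _ : Fin n => μ ⊗ₘ κ) = 0 := by
  obtain _ | m := n
  · exact i.elim0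
  have hbd : ∀ s z, |ψ s * h z| ≤ c * C := fun s z => by
    rw [abs_mul]
    exact mul_le_mul (hψc _) (hhC _) (abs_nonneg _) ((abs_nonneg _).trans (hψc s))
  -- Split off the `i`-th observation; its response is integrated out first, with `X_i` and all
  -- other observations fixed.
  have e := (measurePreserving_piFinSuccAbove (fun _ : Fin (m + 1) => μ ⊗ₘ κ) i).symm
  rw [← e.integral_comp']
  have hm : Measurable fun z => ψ ((MeasurableEquiv.piFinSuccAbove (fun _ => α × β) i).symm z) *
      h ((MeasurableEquiv.piFinSuccAbove (fun _ => α × β) i).symm z i) := by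
    fun_prop
  rw [integral_prod_symm _ (integrable_of_measurable_of_abs_le hm fun z => hbd _ _)]
  refine integral_eq_zero_of_ae (Eventually.of_forall fun t => ?_)
  have hm' := hm.comp (measurable_prodMk_right (y := t))
  simp only [Function.comp_def] at hm'
  simp only [Pi.zero_apply]
  rw [Measure.integral_compProd (integrable_of_measurable_of_abs_le hm' fun z => hbd _ _)]
  refine integral_eq_zero_of_ae (Eventually.of_forall fun x => ?_)
  have : Nonempty β := (κ x).nonempty_of_neZero
  obtain ⟨y₀⟩ := this
  have hsymm : ∀ w : (α × β) × (Fin m → α × β),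
      (MeasurableEquiv.piFinSuccAbove (fun _ => α × β) i).symm w =
        i.insertNth (α := fun _ => α × β) w.1 w.2 := fun _ => rfl
  -- `ψ` ignores the `i`-th response, so a reference value `y₀` may replace it; the inner integral
  -- is then a constant times `∫ h (x, y) = 0`.
  have key : ∀ y, ψ ((MeasurableEquiv.piFinSuccAbove (fun _ => α × β) i).symm ((x, y), t)) =
      ψ ((MeasurableEquiv.piFinSuccAbove (fun _ => α × β) i).symm ((x, y₀), t)) := by
    intro y
    rw [← hψi ((MeasurableEquiv.piFinSuccAbove (fun _ => α × β) i).symm ((x, y₀), t)) y]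
    simp only [hsymm, Fin.update_insertNth, Fin.insertNth_apply_same]
  have key2 : ∀ y, (MeasurableEquiv.piFinSuccAbove (fun _ => α × β) i).symm ((x, y), t) i
      = (x, y) := fun y => by
    rw [hsymm, Fin.insertNth_apply_same]
  simp only [key, key2, Pi.zero_apply, integral_const_mul, h0, mul_zero]

/-- The second moment of a weighted sum of conditionally centered variables. -/
theorem integral_pi_sum_sq {μ : Measure α} [IsProbabilityMeasure μ] {κ : Kernel α β}
    [IsMarkovKernel κ] {n : ℕ} {a : Fin n → (Fin n → α) → ℝ} (ha : ∀ i, Measurable (a i)) {c : ℝ}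
    (hac : ∀ i s, |a i s| ≤ c)
    {h : α × β → ℝ} (hh : Measurable h) {C : ℝ} (hhC : ∀ z, |h z| ≤ C)
    (h0 : ∀ x, ∫ y, h (x, y) ∂(κ x) = 0) :
    ∫ s, (∑ i, a i (fun j => (s j).1) * h (s i)) ^ 2 ∂(Measure.pi fun _ : Fin n => μ ⊗ₘ κ)
      = ∫ s, ∑ i, a i (fun j => (s j).1) ^ 2 * h (s i) ^ 2
          ∂(Measure.pi fun _ : Fin n => μ ⊗ₘ κ) := by
  have hterm : ∀ i j : Fin n, Integrable (fun s : Fin n → α × β =>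
      (a i (fun l => (s l).1) * h (s i)) * (a j (fun l => (s l).1) * h (s j)))
      (Measure.pi fun _ : Fin n => μ ⊗ₘ κ) := by
    intro i j
    have hc : ∀ (i : Fin n) (s : Fin n → α × β),
        |a i (fun l => (s l).1) * h (s i)| ≤ c * C := fun i s => by
      rw [abs_mul]
      exact mul_le_mul (hac _ _) (hhC _) (abs_nonneg _) ((abs_nonneg _).trans (hac i fun l => (s l).1))
    refine integrable_of_measurable_of_abs_le (c := (c * C) * (c * C)) (by fun_prop) fun s => ?_
    rw [abs_mul]
    exact mul_le_mul (hc _ _) (hc _ _) (abs_nonneg _) ((abs_nonneg _).trans (hc i s))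
  have hexp : ∀ s : Fin n → α × β, (∑ i, a i (fun j => (s j).1) * h (s i)) ^ 2 =
      ∑ i, ∑ j, (a i (fun l => (s l).1) * h (s i)) * (a j (fun l => (s l).1) * h (s j)) := by
    intro s
    rw [sq, Finset.sum_mul_sum]
  simp only [hexp]
  rw [integral_finsetSum _ fun i _ => integrable_finsetSum _ fun j _ => hterm i j,
    integral_finsetSum _ fun i _ => ?_]
  · refine Finset.sum_congr rfl fun i _ => ?_
    rw [integral_finsetSum _ fun j _ => hterm i j, Finset.sum_eq_single i]
    · congr 1; ext s; ring
    -- In an off-diagonal term every factor except `h (s j)` depends on the `j`-th observation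
    -- through its covariate only.
    · intro j _ hji
      have := integral_pi_mul_eq_zero (μ := μ) (κ := κ) j
        (ψ := fun s => a i (fun l => (s l).1) * h (s i) * a j (fun l => (s l).1)) (by fun_prop)
        (c := c * C * c) (fun s => ?_) (fun s y => ?_) hh hhC h0
      · rw [← this]; congr 1; ext s; ring
      · rw [abs_mul, abs_mul]
        have h1 := hac i fun l => (s l).1
        have h2 := hac j fun l => (s l).1
        have h3 := hhC (s i)
        have := abs_nonneg (a i fun l => (s l).1)
        have := abs_nonneg (a j fun l => (s l).1)
        have := abs_nonneg (h (s i))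
        gcongr
        · exact mul_nonneg (by linarith) (by linarith)
        · linarith
      · have e1 : (fun l => (Function.update s j ((s j).1, y) l).1) = fun l => (s l).1 := by
          ext l
          by_cases hl : l = j
          · subst hl; simp
          · simp [hl]
        simp only [e1, Function.update_of_ne (Ne.symm hji)]
    · simp
  · refine (hterm i i).congr (Eventually.of_forall fun s => ?_)
    simp only; ring

end SampleLaw

/-! ### Couplings and transport along a partition -/

section Coupling

variable {α β : Type*} [MeasurableSpace α] [MeasurableSpace β]

/-- Two finite measures with the same mass are coupled by the normalized product measure. -/
theorem exists_coupling_lintegral_le {μ : Measure α} {ν : Measure β} [IsFiniteMeasure μ]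
    [IsFiniteMeasure ν] (hμν : μ Set.univ = ν Set.univ) {c : α × β → ℝ≥0∞} {f : α → ℝ≥0∞}
    {g : β → ℝ≥0∞} (hf : Measurable f) (hg : Measurable g)
    (hc : ∀ᵐ x ∂μ, ∀ᵐ y ∂ν, c (x, y) ≤ f x + g y) (hcm : Measurable c) :
    ∃ π : Measure (α × β), π.fst = μ ∧ π.snd = ν ∧
      ∫⁻ z, c z ∂π ≤ ∫⁻ x, f x ∂μ + ∫⁻ y, g y ∂ν := by
  by_cases h0 : μ Set.univ = 0
  · have h1 : μ = 0 := Measure.measure_univ_eq_zero.1 h0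
    have h2 : ν = 0 := Measure.measure_univ_eq_zero.1 (hμν ▸ h0)
    exact ⟨0, by simp [h1], by simp [h2], by simp⟩
  have htop : μ Set.univ ≠ ∞ := measure_ne_top μ _
  refine ⟨(μ Set.univ)⁻¹ • μ.prod ν, ?_, ?_, ?_⟩
  · ext s hs
    rw [Measure.fst_apply hs, Measure.smul_apply, ← Set.prod_univ, Measure.prod_prod, ← hμν,
      smul_eq_mul, mul_comm, mul_assoc, ENNReal.mul_inv_cancel h0 htop, mul_one]
  · ext s hs
    rw [Measure.snd_apply hs, Measure.smul_apply, ← Set.univ_prod, Measure.prod_prod,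
      smul_eq_mul, ← mul_assoc, ENNReal.inv_mul_cancel h0 htop, one_mul]
  · rw [lintegral_smul_measure, lintegral_prod _ hcm.aemeasurable]
    calc (μ Set.univ)⁻¹ • ∫⁻ x, ∫⁻ y, c (x, y) ∂ν ∂μ
        ≤ (μ Set.univ)⁻¹ • ∫⁻ x, ∫⁻ y, f x + g y ∂ν ∂μ := by
          gcongr ?_ • ?_
          refine lintegral_mono_ae ?_
          filter_upwards [hc] with x hx using lintegral_mono_ae hx
      _ = (μ Set.univ)⁻¹ * (μ Set.univ * (∫⁻ x, f x ∂μ + ∫⁻ y, g y ∂ν)) := by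
          simp_rw [lintegral_add_right _ hg, lintegral_const]
          rw [lintegral_add_right _ measurable_const, lintegral_mul_const _ hf, lintegral_const,
            ← hμν, smul_eq_mul]
          ring
      _ = _ := by rw [← mul_assoc, ENNReal.inv_mul_cancel h0 htop, one_mul]
      _ ≤ _ := le_rfl

theorem fst_finsetSum {ι : Type*} (s : Finset ι) (π : ι → Measure (α × β)) :
    (∑ i ∈ s, π i).fst = ∑ i ∈ s, (π i).fst := by
  ext t ht
  simp [Measure.fst_apply ht, Measure.finsetSum_apply]

theorem snd_finsetSum {ι : Type*} (s : Finset ι) (π : ι → Measure (α × β)) :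
    (∑ i ∈ s, π i).snd = ∑ i ∈ s, (π i).snd := by
  ext t ht
  simp [Measure.snd_apply ht, Measure.finsetSum_apply]

theorem restrict_eq_of_disjoint_cover {ι : Type*} [Fintype ι] {B : ι → Set α}
    (hB : ∀ j, MeasurableSet (B j)) (hd : Pairwise (Function.onFun Disjoint B)) (Q : Measure α) :
    Q = Q.restrict (⋃ j, B j)ᶜ + ∑ j, Q.restrict (B j) := by
  conv_lhs => rw [← Measure.restrict_compl_add_restrict (μ := Q) (MeasurableSet.iUnion hB),
    Measure.restrict_iUnion hd hB, Measure.sum_fintype]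

/-- Transport along a finite partition: the common mass of each cell stays in the cell, the rest
is transported arbitrarily. -/
theorem exists_coupling_of_partition {ι : Type*} [Fintype ι] {B : ι → Set α}
    (hB : ∀ j, MeasurableSet (B j)) (hd : Pairwise (Function.onFun Disjoint B))
    {c : α × α → ℝ≥0∞} (hc : Measurable c) {f : α → ℝ≥0∞} (hf : Measurable f)
    (hcf : ∀ x y, c (x, y) ≤ f x + f y)
    {δ : ℝ≥0∞} (hδ : ∀ j, ∀ x ∈ B j, ∀ y ∈ B j, c (x, y) ≤ δ)
    {R : ℝ≥0∞} (hR : ∀ j, ∀ x ∈ B j, f x ≤ R)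
    (Q₁ Q₂ : Measure α) [IsProbabilityMeasure Q₁] [IsProbabilityMeasure Q₂] :
    ∃ π : Measure (α × α), π.fst = Q₁ ∧ π.snd = Q₂ ∧
      ∫⁻ z, c z ∂π ≤ δ + (∑ j, R * ((Q₁ (B j) - Q₂ (B j)) + (Q₂ (B j) - Q₁ (B j)))
        + ∫⁻ x in (⋃ j, B j)ᶜ, f x ∂Q₁ + ∫⁻ x in (⋃ j, B j)ᶜ, f x ∂Q₂) := by
  -- the common and the excess part of `Q` with respect to `Q'`
  let r : Measure α → Measure α → ι → ℝ≥0∞ := fun Q Q' j => min (Q (B j)) (Q' (B j)) / Q (B j)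
  let E : Measure α → Measure α → Measure α := fun Q Q' =>
    Q.restrict (⋃ j, B j)ᶜ + ∑ j, (1 - r Q Q' j) • Q.restrict (B j)
  -- If `Q (B j) = 0` the quotient is `0 / 0 = 0` and both sides vanish.
  have hr : ∀ (Q Q' : Measure α) [IsProbabilityMeasure Q] (j : ι),
      r Q Q' j * Q (B j) = min (Q (B j)) (Q' (B j)) := by
    intro Q Q' _ j
    exact ENNReal.div_mul_cancel' (fun h => by simp [h]) fun h => absurd h (measure_ne_top _ _)
  have hr1 : ∀ (Q Q' : Measure α) (j : ι), r Q Q' j ≤ 1 := fun Q Q' j =>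
    ENNReal.div_le_of_le_mul (by simp)
  have hsplit : ∀ (Q Q' : Measure α) [IsProbabilityMeasure Q],
      Q = E Q Q' + ∑ j, r Q Q' j • Q.restrict (B j) := by
    intro Q Q' _
    conv_lhs => rw [restrict_eq_of_disjoint_cover hB hd Q]
    simp only [E, add_assoc, ← Finset.sum_add_distrib, ← add_smul]
    simp_rw [tsub_add_cancel_of_le (hr1 _ _ _), one_smul]
  have hfin : ∀ (Q Q' : Measure α) [IsProbabilityMeasure Q], IsFiniteMeasure (E Q Q') := by
    intro Q Q' _
    refine ⟨lt_of_le_of_lt ?_ (measure_lt_top Q Set.univ)⟩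
    conv_rhs => rw [hsplit Q Q']
    simp
  have hcm : ∀ (Q Q' : Measure α) [IsProbabilityMeasure Q],
      (∑ j, r Q Q' j • Q.restrict (B j)) Set.univ = ∑ j, min (Q (B j)) (Q' (B j)) := by
    intro Q Q' _
    simp [Measure.finsetSum_apply, hr]
  -- Both total masses are `1` and both common parts have mass `∑ min`, so the excess parts have
  -- equal mass and can be coupled.
  have hmass : E Q₁ Q₂ Set.univ = E Q₂ Q₁ Set.univ := by
    have h1 := congrArg (fun m : Measure α => m Set.univ) (hsplit Q₁ Q₂)
    have h2 := congrArg (fun m : Measure α => m Set.univ) (hsplit Q₂ Q₁)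
    simp only [measure_univ, Measure.add_apply, hcm] at h1 h2
    simp_rw [min_comm (Q₂ _)] at h2
    have hne : ∑ j, min (Q₁ (B j)) (Q₂ (B j)) ≠ ∞ :=
      (lt_of_le_of_lt (by rw [h1]; exact le_add_self) ENNReal.one_lt_top).ne
    exact (ENNReal.add_left_inj hne).1 (h1.symm.trans h2)
  have hEint : ∀ (Q Q' : Measure α) [IsProbabilityMeasure Q], ∫⁻ x, f x ∂(E Q Q') ≤
      ∫⁻ x in (⋃ j, B j)ᶜ, f x ∂Q + ∑ j, R * (Q (B j) - Q' (B j)) := by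
    intro Q Q' _
    simp only [E]
    rw [lintegral_add_measure, lintegral_finsetSum_measure]
    gcongr with j
    rw [lintegral_smul_measure]
    calc (1 - r Q Q' j) • ∫⁻ x in B j, f x ∂Q ≤ (1 - r Q Q' j) • (R * Q (B j)) := by
          gcongr ?_ • ?_
          exact (setLIntegral_mono measurable_const (hR j)).trans_eq (setLIntegral_const _ _)
      _ = R * (Q (B j) - min (Q (B j)) (Q' (B j))) := by
          rw [smul_eq_mul, mul_left_comm, ENNReal.sub_mul (fun _ _ => measure_ne_top _ _), one_mul,
            hr]
      _ ≤ R * (Q (B j) - Q' (B j)) := by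
          gcongr R * ?_
          rcases le_total (Q (B j)) (Q' (B j)) with h | h
          · rw [min_eq_left h, tsub_self]; exact zero_le
          · rw [min_eq_right h]
  have : IsFiniteMeasure (E Q₁ Q₂) := hfin _ _
  have : IsFiniteMeasure (E Q₂ Q₁) := hfin _ _
  obtain ⟨π₀, h₀₁, h₀₂, h₀⟩ := exists_coupling_lintegral_le hmass hf hf
    (Eventually.of_forall fun x => Eventually.of_forall fun y => hcf x y) hc
  have hex : ∀ j, ∃ π : Measure (α × α), π.fst = r Q₁ Q₂ j • Q₁.restrict (B j) ∧
      π.snd = r Q₂ Q₁ j • Q₂.restrict (B j) ∧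
      ∫⁻ z, c z ∂π ≤ δ * min (Q₁ (B j)) (Q₂ (B j)) := by
    intro j
    have f1 : IsFiniteMeasure (r Q₁ Q₂ j • Q₁.restrict (B j)) :=
      ⟨by simp [hr]⟩
    have f2 : IsFiniteMeasure (r Q₂ Q₁ j • Q₂.restrict (B j)) :=
      ⟨by simp [hr]⟩
    -- Both margins live on `B j`, where the cost is at most `δ`; hence the bounding functions `δ`
    -- and `0`.
    obtain ⟨π, h1, h2, h3⟩ := exists_coupling_lintegral_le (μ := r Q₁ Q₂ j • Q₁.restrict (B j))
      (ν := r Q₂ Q₁ j • Q₂.restrict (B j)) (by simp [hr, min_comm]) (c := c) (f := fun _ => δ)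
      (g := fun _ => 0) measurable_const measurable_const
      (Measure.ae_smul_measure ((ae_restrict_iff' (hB j)).2 (Eventually.of_forall fun x hx =>
        Measure.ae_smul_measure ((ae_restrict_iff' (hB j)).2 (Eventually.of_forall fun y hy => by
          simpa using hδ j x hx y hy)) _)) _) hc
    refine ⟨π, h1, h2, h3.trans_eq ?_⟩
    simp [hr]
  choose π h1 h2 h3 using hex
  refine ⟨π₀ + ∑ j, π j, ?_, ?_, ?_⟩
  · rw [Measure.fst_add, fst_finsetSum, h₀₁]
    simp_rw [h1]
    exact (hsplit Q₁ Q₂).symm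
  · rw [Measure.snd_add, snd_finsetSum, h₀₂]
    simp_rw [h2]
    exact (hsplit Q₂ Q₁).symm
  · rw [lintegral_add_measure, lintegral_finsetSum_measure, add_comm]
    gcongr
    · calc ∑ j, ∫⁻ z, c z ∂(π j) ≤ ∑ j, δ * min (Q₁ (B j)) (Q₂ (B j)) := by gcongr; exact h3 _
        _ ≤ δ * 1 := by
          rw [← Finset.mul_sum]
          gcongr
          rw [← hcm, ← measure_univ (μ := Q₁)]
          conv_rhs => rw [hsplit Q₁ Q₂]
          simp
        _ = δ := mul_one δ
    · refine h₀.trans ((add_le_add (hEint Q₁ Q₂) (hEint Q₂ Q₁)).trans_eq ?_)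
      simp only [mul_add, Finset.sum_add_distrib]
      ring

end Coupling

/-! ### Upper and lower bounds for the Wasserstein distance -/

section Wasserstein

variable {d : ℕ}

theorem wassersteinDist_rpow_le {p : ℝ} (hp : 0 < p) {Q₁ Q₂ : Measure (Euc d)}
    {π : Measure (Euc d × Euc d)} (h₁ : π.fst = Q₁) (h₂ : π.snd = Q₂) :
    wassersteinDist p Q₁ Q₂ ^ p ≤ ∫⁻ y, ‖y.1 - y.2‖ₑ ^ p ∂π := by
  calc wassersteinDist p Q₁ Q₂ ^ p ≤ ((∫⁻ y, ‖y.1 - y.2‖ₑ ^ p ∂π) ^ (1 / p)) ^ p :=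
        ENNReal.rpow_le_rpow (iInf₂_le π ⟨h₁, h₂⟩) hp.le
    _ = _ := by rw [← ENNReal.rpow_mul, one_div_mul_cancel hp.ne', ENNReal.rpow_one]

theorem le_wassersteinDist_rpow {p : ℝ} (hp : 0 < p) {Q₁ Q₂ : Measure (Euc d)} {L : ℝ≥0∞}
    (h : ∀ π : Measure (Euc d × Euc d), π.fst = Q₁ → π.snd = Q₂ →
      L ≤ ∫⁻ y, ‖y.1 - y.2‖ₑ ^ p ∂π) :
    L ≤ wassersteinDist p Q₁ Q₂ ^ p := by
  rw [← ENNReal.rpow_inv_le_iff hp, ← one_div]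
  exact le_iInf₂ fun π hπ => ENNReal.rpow_le_rpow (h π hπ.1 hπ.2) (by positivity)

theorem enorm_sub_rpow_le {p : ℝ} (hp : 1 ≤ p) (x y : Euc d) :
    ‖x - y‖ₑ ^ p ≤ 2 ^ (p - 1) * ‖x‖ₑ ^ p + 2 ^ (p - 1) * ‖y‖ₑ ^ p := by
  rw [← mul_add]
  exact (ENNReal.rpow_le_rpow (enorm_sub_le) (by linarith)).trans
    (ENNReal.rpow_add_le_mul_rpow_add_rpow _ _ hp)

theorem wassersteinDist_rpow_le_of_partition {p : ℝ} (hp : 1 ≤ p) {ι : Type*} [Fintype ι]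
    {B : ι → Set (Euc d)} (hB : ∀ j, MeasurableSet (B j))
    (hd : Pairwise (Function.onFun Disjoint B))
    {δ : ℝ≥0∞} (hδ : ∀ j, ∀ x ∈ B j, ∀ y ∈ B j, ‖x - y‖ₑ ^ p ≤ δ)
    {R : ℝ≥0∞} (hR : ∀ j, ∀ x ∈ B j, 2 ^ (p - 1) * ‖x‖ₑ ^ p ≤ R)
    (Q₁ Q₂ : Measure (Euc d)) [IsProbabilityMeasure Q₁] [IsProbabilityMeasure Q₂] :
    wassersteinDist p Q₁ Q₂ ^ p ≤
      δ + (∑ j, R * ((Q₁ (B j) - Q₂ (B j)) + (Q₂ (B j) - Q₁ (B j)))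
        + ∫⁻ y in (⋃ j, B j)ᶜ, 2 ^ (p - 1) * ‖y‖ₑ ^ p ∂Q₁
        + ∫⁻ y in (⋃ j, B j)ᶜ, 2 ^ (p - 1) * ‖y‖ₑ ^ p ∂Q₂) := by
  obtain ⟨π, h₁, h₂, h⟩ := exists_coupling_of_partition hB hd
    (c := fun z => ‖z.1 - z.2‖ₑ ^ p) (by fun_prop) (f := fun y => 2 ^ (p - 1) * ‖y‖ₑ ^ p)
    (by fun_prop) (enorm_sub_rpow_le hp) hδ hR Q₁ Q₂
  exact (wassersteinDist_rpow_le (by linarith) h₁ h₂).trans h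

/-- The distance to a Dirac mass. -/
theorem lintegral_le_wassersteinDist_dirac {p : ℝ} (hp : 0 < p) (Q : Measure (Euc d)) (a : Euc d) :
    ∫⁻ y, ‖y - a‖ₑ ^ p ∂Q ≤ wassersteinDist p Q (Measure.dirac a) ^ p := by
  refine le_wassersteinDist_rpow hp fun π h₁ h₂ => ?_
  -- Every coupling with a Dirac mass has constant second coordinate, so the cost depends on the
  -- first margin only.
  have hae : ∀ᵐ z ∂π, z.2 = a := by
    have : ∀ᵐ y ∂π.snd, y = a := by
      rw [h₂]
      exact (ae_dirac_iff (measurableSet_singleton a)).2 rfl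
    exact ae_of_ae_map measurable_snd.aemeasurable this
  rw [← h₁, Measure.fst, lintegral_map (by fun_prop) measurable_fst]
  refine lintegral_mono_ae ?_
  filter_upwards [hae] with z hz
  rw [hz]

/-- Nonexpansive functions have close integrals under measures close in Wasserstein distance. -/
theorem lintegral_le_add_wassersteinDist {p : ℝ} (hp : 1 ≤ p) {Q₁ Q₂ : Measure (Euc d)}
    [IsProbabilityMeasure Q₁] {φ : Euc d → ℝ≥0∞} (hφ : Measurable φ)
    (hφL : ∀ x y, φ x ≤ φ y + ‖x - y‖ₑ) {η : ℝ≥0∞} (hη : η ≠ 0) (hη' : η ≠ ∞) :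
    ∫⁻ y, φ y ∂Q₁ ≤ ∫⁻ y, φ y ∂Q₂ + η + η ^ (1 - p) * wassersteinDist p Q₁ Q₂ ^ p ∧
    ∫⁻ y, φ y ∂Q₂ ≤ ∫⁻ y, φ y ∂Q₁ + η + η ^ (1 - p) * wassersteinDist p Q₁ Q₂ ^ p := by
  -- For `t ≥ η`, `t = t ^ (1 - p) * t ^ p` and the exponent `1 - p` is nonpositive. The bound is
  -- affine in `t ^ p`, so it can be integrated without taking `p`-th roots.
  have hpt : ∀ t : ℝ≥0∞, t ≤ η + η ^ (1 - p) * t ^ p := by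
    intro t
    rcases le_total t η with h | h
    · exact h.trans le_self_add
    · refine le_trans (b := η ^ (1 - p) * t ^ p) ?_ le_add_self
      rcases eq_or_ne t ∞ with rfl | ht
      · rw [ENNReal.top_rpow_of_pos (by linarith), ENNReal.mul_top]
        exact (ENNReal.rpow_pos (pos_iff_ne_zero.2 hη) hη').ne'
      calc t = t ^ (1 - p) * t ^ p := by
            rw [← ENNReal.rpow_add _ _ (fun h0 => hη (nonpos_iff_eq_zero.1 (h0 ▸ h))) ht]
            simp
        _ ≤ η ^ (1 - p) * t ^ p := by
            gcongr ?_ * _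
            rw [← neg_sub p 1, ENNReal.rpow_neg, ENNReal.rpow_neg, ENNReal.inv_le_inv]
            exact ENNReal.rpow_le_rpow h (by linarith)
  have hne : η ^ (1 - p) ≠ ∞ := ENNReal.rpow_ne_top_of_ne_zero hη hη'
  have hη0 : η ^ (1 - p) ≠ 0 := (ENNReal.rpow_pos (pos_iff_ne_zero.2 hη) hη').ne'
  have key : ∀ π : Measure (Euc d × Euc d), π.fst = Q₁ → π.snd = Q₂ →
      ∫⁻ z, ‖z.1 - z.2‖ₑ ∂π ≤ η + η ^ (1 - p) * ∫⁻ z, ‖z.1 - z.2‖ₑ ^ p ∂π := by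
    intro π h₁ h₂
    have hπ : π Set.univ = 1 := by
      rw [← Measure.fst_univ, h₁, measure_univ]
    calc ∫⁻ z, ‖z.1 - z.2‖ₑ ∂π ≤ ∫⁻ z, η + η ^ (1 - p) * ‖z.1 - z.2‖ₑ ^ p ∂π :=
          lintegral_mono fun z => hpt _
      _ = _ := by
          rw [lintegral_add_left measurable_const, lintegral_const, hπ, mul_one,
            lintegral_const_mul _ (by fun_prop)]
  have main : ∀ A B : ℝ≥0∞, (∀ π : Measure (Euc d × Euc d), π.fst = Q₁ → π.snd = Q₂ →
      A ≤ B + ∫⁻ z, ‖z.1 - z.2‖ₑ ∂π) →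
      A ≤ B + η + η ^ (1 - p) * wassersteinDist p Q₁ Q₂ ^ p := by
    intro A B h
    -- Isolating the distance on one side turns the claim into a lower bound for the cost of every
    -- coupling.
    rw [← tsub_le_iff_left, mul_comm, ← ENNReal.div_le_iff hη0 hne]
    refine le_wassersteinDist_rpow (by linarith) fun π h₁ h₂ => ?_
    rw [ENNReal.div_le_iff hη0 hne, mul_comm, tsub_le_iff_left, add_assoc]
    exact (h π h₁ h₂).trans (by gcongr; exact key π h₁ h₂)
  constructor
  · refine main _ _ fun π h₁ h₂ => ?_
    rw [← h₁, ← h₂, Measure.fst, Measure.snd, lintegral_map hφ measurable_fst,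
      lintegral_map hφ measurable_snd, ← lintegral_add_left (by fun_prop)]
    exact lintegral_mono fun z => hφL _ _
  · refine main _ _ fun π h₁ h₂ => ?_
    rw [← h₁, ← h₂, Measure.fst, Measure.snd, lintegral_map hφ measurable_fst,
      lintegral_map hφ measurable_snd, ← lintegral_add_left (by fun_prop)]
    refine lintegral_mono fun z => (hφL _ z.1).trans_eq ?_
    rw [enorm_sub_rev]

end Wasserstein

theorem exists_pos_ofReal_le {ε : ℝ≥0∞} (hε : 0 < ε) : ∃ η : ℝ, 0 < η ∧ ENNReal.ofReal η ≤ ε := by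
  obtain ⟨η, h0, h1⟩ := ENNReal.lt_iff_exists_nnreal_btwn.1 hε
  exact ⟨η, by exact_mod_cast h0, by simpa using h1.le⟩

/-! ### Conditioning on covariates; convergence in probability and in mean -/

section SampleLaw

variable {α β : Type*} [MeasurableSpace α] [MeasurableSpace β]

/-- Conditioning on the covariates in the sample. -/
theorem lintegral_pi_mul {μ : Measure α} [IsProbabilityMeasure μ] {κ : Kernel α β}
    [IsMarkovKernel κ] {n : ℕ} (i : Fin n) {a : (Fin n → α) → ℝ≥0∞} (ha : Measurable a)
    {u : α × β → ℝ≥0∞} (hu : Measurable u) :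
    ∫⁻ s, a (fun j => (s j).1) * u (s i) ∂(Measure.pi fun _ : Fin n => μ ⊗ₘ κ) =
      ∫⁻ x, a x * ∫⁻ y, u (x i, y) ∂(κ (x i)) ∂(Measure.pi fun _ : Fin n => μ) := by
  obtain _ | m := n
  · exact i.elim0
  obtain ⟨g, hg, hug⟩ : ∃ g : α → ℝ≥0∞, Measurable g ∧ ∀ x, ∫⁻ y, u (x, y) ∂(κ x) = g x :=
    ⟨_, hu.lintegral_kernel_prod_right', fun _ => rfl⟩
  simp only [hug]
  have hfst : MeasurePreserving (Prod.fst : α × β → α) (μ ⊗ₘ κ) μ :=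
    ⟨measurable_fst, Measure.fst_compProd μ κ⟩
  have hmp := measurePreserving_pi (fun _ : Fin (m + 1) => μ ⊗ₘ κ) (fun _ => μ) fun _ => hfst
  rw [← hmp.lintegral_comp (by fun_prop)]
  have e := (measurePreserving_piFinSuccAbove (fun _ : Fin (m + 1) => μ ⊗ₘ κ) i).symm
  have hsymm : ∀ w : (α × β) × (Fin m → α × β),
      (MeasurableEquiv.piFinSuccAbove (fun _ => α × β) i).symm w =
        i.insertNth (α := fun _ => α × β) w.1 w.2 := fun _ => rfl
  rw [← e.lintegral_comp (by fun_prop), ← e.lintegral_comp (by fun_prop),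
    lintegral_prod_symm _ (by fun_prop), lintegral_prod_symm _ (by fun_prop)]
  refine lintegral_congr fun t => ?_
  rw [Measure.lintegral_compProd (by fun_prop), Measure.lintegral_compProd (by fun_prop)]
  refine lintegral_congr fun x => ?_
  have hfun : ∀ y, (fun j => (i.insertNth (α := fun _ => α × β) (x, y) t j).1) =
      i.insertNth (α := fun _ => α) x fun j => (t j).1 := by
    intro y
    ext j
    refine Fin.succAboveCases i ?_ (fun l => ?_) j <;> simp
  simp only [hsymm, Fin.insertNth_apply_same, hfun]
  rw [lintegral_const_mul _ (by fun_prop), hug, lintegral_const, measure_univ, mul_one]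

/-- The coefficients involve covariates only, so each response can be integrated out given its own
covariate. Tail moments and variances of responses thus become functions of the covariates. -/
theorem lintegral_sampleLaw_sum_mul {μ : Measure α} [IsProbabilityMeasure μ] {κ : Kernel α β}
    [IsMarkovKernel κ] {n : ℕ} {a : Fin n → α × (Fin n → α) → ℝ≥0∞} (ha : ∀ i, Measurable (a i))
    {u : α × β → ℝ≥0∞} (hu : Measurable u) :
    ∫⁻ z, ∑ i, a i (z.1.1, fun j => (z.2 j).1) * u (z.2 i) ∂(sampleLaw (μ ⊗ₘ κ) n) =
      ∫⁻ z, ∑ i, a i z * ∫⁻ y, u (z.2 i, y) ∂(κ (z.2 i)) ∂(sampleLaw μ n) := by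
  obtain ⟨g, hg, hug⟩ : ∃ g : α → ℝ≥0∞, Measurable g ∧ ∀ x, ∫⁻ y, u (x, y) ∂(κ x) = g x :=
    ⟨_, hu.lintegral_kernel_prod_right', fun _ => rfl⟩
  have hfst : MeasurePreserving (Prod.fst : α × β → α) (μ ⊗ₘ κ) μ :=
    ⟨measurable_fst, Measure.fst_compProd μ κ⟩
  have hm : Measurable fun z : α × (Fin n → α) => ∑ i, a i z * g (z.2 i) := by fun_prop
  have hm' := hm.lintegral_prod_right' (ν := Measure.pi fun _ : Fin n => μ)
  simp only [hug]
  rw [sampleLaw, sampleLaw, lintegral_prod _ (by fun_prop), lintegral_prod _ hm.aemeasurable,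
    ← hfst.lintegral_comp hm']
  refine lintegral_congr fun w => ?_
  have ha' : ∀ i, Measurable fun xs => a i (w.1, xs) := fun i =>
    (ha i).comp measurable_prodMk_left
  rw [lintegral_finsetSum _ fun i _ => by fun_prop, lintegral_finsetSum _ fun i _ => by fun_prop]
  refine Finset.sum_congr rfl fun i _ => ?_
  simpa only [hug] using lintegral_pi_mul (μ := μ) (κ := κ) i (ha' i) hu

/-- Split at a small level `η`: below it the integrand is small, above it the bound by `1` leaves
the measure of the exceptional set. -/
theorem tendsto_lintegral_ofReal_of_tendsto_measure {Ω : ℕ → Type*} [∀ n, MeasurableSpace (Ω n)]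
    (ν : ∀ n, Measure (Ω n)) [∀ n, IsProbabilityMeasure (ν n)] {f : ∀ n, Ω n → ℝ}
    (h1 : ∀ᶠ n in atTop, ∀ z, f n z ≤ 1)
    (h : ∀ η : ℝ, 0 < η → Tendsto (fun n => ν n {z | η < f n z}) atTop (𝓝 0)) :
    Tendsto (fun n => ∫⁻ z, ENNReal.ofReal (f n z) ∂(ν n)) atTop (𝓝 0) := by
  refine tendsto_zero_of_forall_eventually_le_add fun ε hε => ?_
  obtain ⟨η, hη, hηε⟩ := exists_pos_ofReal_le hε
  refine ⟨_, h η hη, ?_⟩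
  filter_upwards [h1] with n hn
  calc ∫⁻ z, ENNReal.ofReal (f n z) ∂(ν n)
      ≤ ∫⁻ z, ENNReal.ofReal η + {z | η < f n z}.indicator 1 z ∂(ν n) := by
        refine lintegral_mono fun z => ?_
        by_cases hz : η < f n z
        · rw [Set.indicator_of_mem (by exact hz)]
          exact (ENNReal.ofReal_le_one.2 (hn z)).trans le_add_self
        · exact (ENNReal.ofReal_le_ofReal (not_lt.1 hz)).trans le_self_add
    _ ≤ ε + ν n {z | η < f n z} := by
        rw [lintegral_add_left measurable_const, lintegral_const, measure_univ, mul_one]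
        exact add_le_add hηε (lintegral_indicator_one_le _)

/-- Markov's inequality. -/
theorem tendsto_measure_of_tendsto_lintegral_ofReal {Ω : ℕ → Type*} [∀ n, MeasurableSpace (Ω n)]
    (ν : ∀ n, Measure (Ω n)) {f : ∀ n, Ω n → ℝ} (hf : ∀ᶠ n in atTop, Measurable (f n))
    (h : Tendsto (fun n => ∫⁻ z, ENNReal.ofReal (f n z) ∂(ν n)) atTop (𝓝 0))
    {η : ℝ} (hη : 0 < η) : Tendsto (fun n => ν n {z | η < f n z}) atTop (𝓝 0) := by
  have h0 : ENNReal.ofReal η ≠ 0 := (ENNReal.ofReal_pos.2 hη).ne'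
  have h' := ENNReal.Tendsto.div_const h (Or.inr h0)
  rw [ENNReal.zero_div] at h'
  refine tendsto_of_tendsto_of_tendsto_of_le_of_le' tendsto_const_nhds h'
    (Eventually.of_forall fun _ => zero_le) ?_
  filter_upwards [hf] with n hn
  refine le_trans (measure_mono fun z hz => ?_) (meas_ge_le_lintegral_div
    (hn.ennreal_ofReal.aemeasurable) h0 ENNReal.ofReal_ne_top)
  exact ENNReal.ofReal_le_ofReal (le_of_lt hz)

end SampleLaw

/-! ### Weighted empirical measures -/

section Weights

variable {k d : ℕ} {W : LocalWeights k}

namespace IsProbabilityWeights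

theorem le_one (hW : IsProbabilityWeights W) {n : ℕ} (hn : 1 ≤ n) (i : Fin n) (x : Euc k)
    (xs : Fin n → Euc k) : W n i x xs ≤ 1 := by
  rw [← hW.sum_eq_one n hn x xs]
  exact Finset.single_le_sum (f := fun i => W n i x xs) (fun j _ => hW.nonneg n hn j x xs)
    (Finset.mem_univ i)

theorem sum_ofReal (hW : IsProbabilityWeights W) {n : ℕ} (hn : 1 ≤ n) (x : Euc k)
    (xs : Fin n → Euc k) : ∑ i, ENNReal.ofReal (W n i x xs) = 1 := by
  rw [← ENNReal.ofReal_sum_of_nonneg fun i _ => hW.nonneg n hn i x xs, hW.sum_eq_one n hn,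
    ENNReal.ofReal_one]

theorem measurable_sample (hW : IsProbabilityWeights W) {n : ℕ} (hn : 1 ≤ n) (i : Fin n) :
    Measurable fun z : (Euc k × Euc d) × (Fin n → Euc k × Euc d) =>
      W n i z.1.1 fun j => (z.2 j).1 :=
  (hW.measurable n hn i).comp (by fun_prop :
    Measurable fun z : (Euc k × Euc d) × (Fin n → Euc k × Euc d) => (z.1.1, fun j => (z.2 j).1))

theorem measurable_right (hW : IsProbabilityWeights W) {n : ℕ} (hn : 1 ≤ n) (i : Fin n)
    (x : Euc k) : Measurable fun xs : Fin n → Euc k => W n i x xs :=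
  (hW.measurable n hn i).comp measurable_prodMk_left

theorem isProbabilityMeasure_weightedEmpirical (hW : IsProbabilityWeights W) {n : ℕ} (hn : 1 ≤ n)
    (s : Fin n → Euc k × Euc d) (x : Euc k) : IsProbabilityMeasure (weightedEmpirical W s x) := by
  refine ⟨?_⟩
  simp [weightedEmpirical, Measure.finsetSum_apply, hW.sum_ofReal hn]

end IsProbabilityWeights

theorem lintegral_weightedEmpirical {n : ℕ} (s : Fin n → Euc k × Euc d) (x : Euc k)
    (f : Euc d → ℝ≥0∞) :
    ∫⁻ y, f y ∂(weightedEmpirical W s x) =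
      ∑ i, ENNReal.ofReal (W n i x fun j => (s j).1) * f (s i).2 := by
  simp [weightedEmpirical, lintegral_finsetSum_measure, lintegral_smul_measure]

theorem weightedEmpirical_apply {n : ℕ} (s : Fin n → Euc k × Euc d) (x : Euc k)
    {B : Set (Euc d)} (hB : MeasurableSet B) :
    weightedEmpirical W s x B =
      ∑ i, ENNReal.ofReal (W n i x fun j => (s j).1) * B.indicator 1 (s i).2 := by
  rw [← lintegral_indicator_one hB, lintegral_weightedEmpirical]

/-- One of the two truncated differences is zero and the other is the absolute difference. -/
theorem enorm_toReal_sub_toReal {a b : ℝ≥0∞} (ha : a ≠ ∞) (hb : b ≠ ∞) :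
    ‖a.toReal - b.toReal‖ₑ = (a - b) + (b - a) := by
  rcases le_total a b with h | h
  · rw [tsub_eq_zero_of_le h, zero_add, enorm_sub_rev, ← ENNReal.toReal_sub_of_le h hb,
      Real.enorm_of_nonneg ENNReal.toReal_nonneg, ENNReal.ofReal_toReal (by finiteness)]
  · rw [tsub_eq_zero_of_le h, add_zero, ← ENNReal.toReal_sub_of_le h ha,
      Real.enorm_of_nonneg ENNReal.toReal_nonneg, ENNReal.ofReal_toReal (by finiteness)]

end Weights

/-! ### Consequences of Stone's conditions: bias and variance -/

section Stone

variable {k d : ℕ} {W : LocalWeights k} {μ : Measure (Euc k)} [IsProbabilityMeasure μ]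

/-- Stone's first condition for functions with values in `[0, ∞]`. -/
theorem lintegral_weights_le {C : ℝ≥0} (hC : 0 < C)
    (h : ∀ n : ℕ, 1 ≤ n → ∀ g : Euc k → ℝ≥0, Measurable g → ∫⁻ x, (g x : ℝ≥0∞) ∂μ < ∞ →
      ∫⁻ z, ∑ i, ENNReal.ofReal (W n i z.1 z.2) * (g (z.2 i) : ℝ≥0∞) ∂(sampleLaw μ n)
        ≤ (C : ℝ≥0∞) * ∫⁻ x, (g x : ℝ≥0∞) ∂μ) {n : ℕ} (hn : 1 ≤ n)
    {g : Euc k → ℝ≥0∞} (hg : Measurable g) :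
    ∫⁻ z, ∑ i, ENNReal.ofReal (W n i z.1 z.2) * g (z.2 i) ∂(sampleLaw μ n)
      ≤ (C : ℝ≥0∞) * ∫⁻ x, g x ∂μ := by
  rcases eq_or_ne (∫⁻ x, g x ∂μ) ∞ with hi | hi
  · rw [hi, ENNReal.mul_top (by exact_mod_cast hC.ne')]
    exact le_top
  -- A function with finite integral is finite almost everywhere, and each `X_i` has law `μ`, so
  -- infinite values can be discarded on the sample as well.
  have hae : ∀ᵐ x ∂μ, ((g x).toNNReal : ℝ≥0∞) = g x := by
    filter_upwards [ae_lt_top hg hi] with x hx using ENNReal.coe_toNNReal hx.ne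
  have hint := lintegral_congr_ae hae
  have hae' : ∀ᵐ z ∂(sampleLaw μ n), ∀ i : Fin n,
      ((g (z.2 i)).toNNReal : ℝ≥0∞) = g (z.2 i) :=
    ae_all_iff.2 fun i => (measurePreserving_eval_sampleLaw μ i).quasiMeasurePreserving.ae hae
  have := h n hn (fun x => (g x).toNNReal) hg.ennreal_toNNReal
    (by rw [hint]; exact hi.lt_top)
  rw [hint] at this
  refine le_trans (le_of_eq (lintegral_congr_ae ?_)) this
  filter_upwards [hae'] with z hz
  simp only [hz]

theorem tendsto_lintegral_local_mass (hW : IsProbabilityWeights W) (hS : StoneConditions μ W)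
    {ε : ℝ} (hε : 0 < ε) :
    Tendsto (fun n : ℕ => ∫⁻ z, ∑ i, ENNReal.ofReal (W n i z.1 z.2) *
      {x : Euc k | ε < ‖x - z.1‖}.indicator 1 (z.2 i) ∂(sampleLaw μ n)) atTop (𝓝 0) := by
  refine (tendsto_lintegral_ofReal_of_tendsto_measure _ ?_ (hS.local_mass ε hε)).congr' ?_
  · filter_upwards [eventually_ge_atTop 1] with n hn z
    rw [← hW.sum_eq_one n hn z.1 z.2]
    refine Finset.sum_le_sum fun i _ => mul_le_of_le_one_right (hW.nonneg n hn _ _ _) ?_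
    exact Set.indicator_le_self' (fun _ _ => zero_le_one) _
  · filter_upwards [eventually_ge_atTop 1] with n hn
    refine lintegral_congr fun z => ?_
    rw [ENNReal.ofReal_sum_of_nonneg fun i _ =>
      mul_nonneg (hW.nonneg n hn _ _ _)
        (Set.indicator_nonneg (f := (1 : Euc k → ℝ)) (fun _ _ => zero_le_one) _)]
    refine Finset.sum_congr rfl fun i _ => ?_
    rw [ENNReal.ofReal_mul (hW.nonneg n hn _ _ _)]
    by_cases h : ε < ‖z.2 i - z.1‖ <;> simp [Set.indicator, h]

theorem measurable_indicator_norm_sub_lt {n : ℕ} (ε : ℝ) (i : Fin n) :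
    Measurable fun z : Euc k × (Fin n → Euc k) =>
      {x : Euc k | ε < ‖x - z.1‖}.indicator (1 : Euc k → ℝ≥0∞) (z.2 i) := by
  have : (fun z : Euc k × (Fin n → Euc k) =>
      {x : Euc k | ε < ‖x - z.1‖}.indicator (1 : Euc k → ℝ≥0∞) (z.2 i)) =
      {z : Euc k × (Fin n → Euc k) | ε < ‖z.2 i - z.1‖}.indicator 1 := rfl
  rw [this]
  exact measurable_one.indicator (measurableSet_lt (by fun_prop) (by fun_prop))

/-- Covariates near `X` contribute at most the modulus of continuity; the others contribute at most
`2M` times their weight, which vanishes by ii). -/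
theorem tendsto_lintegral_weights_sub_of_uniformContinuous (hW : IsProbabilityWeights W)
    (hS : StoneConditions μ W) {f : Euc k → ℝ} (hf : UniformContinuous f) {M : ℝ}
    (hM : ∀ x, |f x| ≤ M) :
    Tendsto (fun n : ℕ => ∫⁻ z, ∑ i, ENNReal.ofReal (W n i z.1 z.2) * ‖f (z.2 i) - f z.1‖ₑ
      ∂(sampleLaw μ n)) atTop (𝓝 0) := by
  refine tendsto_zero_of_forall_eventually_le_add fun ε hε => ?_
  obtain ⟨η, hη, hηε⟩ := exists_pos_ofReal_le hε
  obtain ⟨τ, hτ, h⟩ := Metric.uniformContinuous_iff.1 hf η hη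
  -- The radius is halved because off the far set only `‖X_i - X‖ ≤ τ / 2` is known, while uniform
  -- continuity asks for a strict inequality.
  have hlim := ENNReal.Tendsto.const_mul (a := ENNReal.ofReal (M + M))
    (tendsto_lintegral_local_mass hW hS (half_pos hτ)) (Or.inr ENNReal.ofReal_ne_top)
  rw [mul_zero] at hlim
  refine ⟨_, hlim, ?_⟩
  filter_upwards [eventually_ge_atTop 1] with n hn
  have hWm := hW.measurable n hn
  have hbound : ∀ z : Euc k × (Fin n → Euc k), ∀ i, ‖f (z.2 i) - f z.1‖ₑ ≤
      ε + ENNReal.ofReal (M + M) * {x : Euc k | τ / 2 < ‖x - z.1‖}.indicator 1 (z.2 i) := by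
    intro z i
    by_cases hz : τ / 2 < ‖z.2 i - z.1‖
    · rw [Set.indicator_of_mem (by exact hz), Pi.one_apply, mul_one, Real.enorm_eq_ofReal_abs]
      exact (ENNReal.ofReal_le_ofReal ((abs_sub _ _).trans (add_le_add (hM _) (hM _)))).trans
        le_add_self
    · have := h (a := z.2 i) (b := z.1) (by rw [dist_eq_norm]; linarith)
      rw [Real.dist_eq] at this
      rw [Real.enorm_eq_ofReal_abs]
      exact ((ENNReal.ofReal_le_ofReal this.le).trans hηε).trans le_self_add
  have hm := fun i : Fin n => measurable_indicator_norm_sub_lt (k := k) (τ / 2) i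
  calc ∫⁻ z, ∑ i, ENNReal.ofReal (W n i z.1 z.2) * ‖f (z.2 i) - f z.1‖ₑ ∂(sampleLaw μ n)
      ≤ ∫⁻ z, ε + ENNReal.ofReal (M + M) * ∑ i, ENNReal.ofReal (W n i z.1 z.2) *
          {x : Euc k | τ / 2 < ‖x - z.1‖}.indicator 1 (z.2 i) ∂(sampleLaw μ n) := by
        refine lintegral_mono fun z => ?_
        calc ∑ i, ENNReal.ofReal (W n i z.1 z.2) * ‖f (z.2 i) - f z.1‖ₑ
            ≤ ∑ i, ENNReal.ofReal (W n i z.1 z.2) * (ε + ENNReal.ofReal (M + M) *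
                {x : Euc k | τ / 2 < ‖x - z.1‖}.indicator 1 (z.2 i)) := by
              gcongr; exact hbound _ _
          _ = (∑ i, ENNReal.ofReal (W n i z.1 z.2)) * ε + ENNReal.ofReal (M + M) *
                ∑ i, ENNReal.ofReal (W n i z.1 z.2) *
                {x : Euc k | τ / 2 < ‖x - z.1‖}.indicator 1 (z.2 i) := by
              rw [Finset.mul_sum, Finset.sum_mul, ← Finset.sum_add_distrib]
              exact Finset.sum_congr rfl fun i _ => by ring
          _ = _ := by rw [hW.sum_ofReal hn, one_mul]
    _ = _ := by
        rw [lintegral_add_left measurable_const, lintegral_const, measure_univ, mul_one,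
          lintegral_const_mul _ (by fun_prop)]

/-- The bias term: bounded measurable functions are well approximated by their local averages. -/
theorem tendsto_lintegral_weights_sub (hW : IsProbabilityWeights W) (hS : StoneConditions μ W)
    {m : Euc k → ℝ} (hm : Measurable m) {M : ℝ} (hM : ∀ x, |m x| ≤ M) :
    Tendsto (fun n : ℕ => ∫⁻ z, ∑ i, ENNReal.ofReal (W n i z.1 z.2) * ‖m (z.2 i) - m z.1‖ₑ
      ∂(sampleLaw μ n)) atTop (𝓝 0) := by
  obtain ⟨C, hC, hCb⟩ := hS.bounded
  refine tendsto_zero_of_forall_eventually_le_add fun ε hε => ?_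
  -- The approximation error enters at the points `X_i`, with factor `C` by i), and at `X`, with
  -- factor `1`.
  have hε' : ε / (C + 1) ≠ 0 := (ENNReal.div_pos hε.ne' (by finiteness)).ne'
  obtain ⟨f, hfs, hfm, hfc, -⟩ :=
    (integrable_of_measurable_of_abs_le (μ := μ) hm hM).exists_hasCompactSupport_lintegral_sub_le
      hε'
  obtain ⟨M', hM'⟩ := hfs.exists_bound_of_continuous hfc
  have hfmeas := hfc.measurable
  refine ⟨_, tendsto_lintegral_weights_sub_of_uniformContinuous hW hS
    (hfs.uniformContinuous_of_continuous hfc) hM', ?_⟩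
  filter_upwards [eventually_ge_atTop 1] with n hn
  have hWm := hW.measurable n hn
  calc ∫⁻ z, ∑ i, ENNReal.ofReal (W n i z.1 z.2) * ‖m (z.2 i) - m z.1‖ₑ ∂(sampleLaw μ n)
      ≤ ∫⁻ z, (∑ i, ENNReal.ofReal (W n i z.1 z.2) * ‖m (z.2 i) - f (z.2 i)‖ₑ)
          + ‖m z.1 - f z.1‖ₑ
          + ∑ i, ENNReal.ofReal (W n i z.1 z.2) * ‖f (z.2 i) - f z.1‖ₑ ∂(sampleLaw μ n) := by
        refine lintegral_mono fun z => ?_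
        calc ∑ i, ENNReal.ofReal (W n i z.1 z.2) * ‖m (z.2 i) - m z.1‖ₑ
            ≤ ∑ i, ENNReal.ofReal (W n i z.1 z.2) * (‖m (z.2 i) - f (z.2 i)‖ₑ
                + ‖m z.1 - f z.1‖ₑ + ‖f (z.2 i) - f z.1‖ₑ) := by
              gcongr with i
              calc ‖m (z.2 i) - m z.1‖ₑ
                  = ‖(m (z.2 i) - f (z.2 i)) - (m z.1 - f z.1) + (f (z.2 i) - f z.1)‖ₑ := by
                    congr 1; ring
                _ ≤ _ := (enorm_add_le _ _).trans (by gcongr; exact enorm_sub_le)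
          _ = _ := by
              simp_rw [mul_add, Finset.sum_add_distrib]
              rw [← Finset.sum_mul, hW.sum_ofReal hn, one_mul]
    _ = (∫⁻ z, ∑ i, ENNReal.ofReal (W n i z.1 z.2) * ‖m (z.2 i) - f (z.2 i)‖ₑ ∂(sampleLaw μ n))
          + ∫⁻ x, ‖m x - f x‖ₑ ∂μ
          + ∫⁻ z, ∑ i, ENNReal.ofReal (W n i z.1 z.2) * ‖f (z.2 i) - f z.1‖ₑ ∂(sampleLaw μ n) := by
        rw [lintegral_add_left (by fun_prop), lintegral_add_left (by fun_prop),
          ← (measurePreserving_fst_sampleLaw μ n).lintegral_comp (f := fun x => ‖m x - f x‖ₑ)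
            (by fun_prop)]
    _ ≤ _ := by
        gcongr
        calc _ ≤ C * ∫⁻ x, ‖m x - f x‖ₑ ∂μ + ∫⁻ x, ‖m x - f x‖ₑ ∂μ := by
              gcongr
              exact lintegral_weights_le hC hCb hn (g := fun x => ‖m x - f x‖ₑ) (by fun_prop)
          _ = (C + 1) * ∫⁻ x, ‖m x - f x‖ₑ ∂μ := by ring
          _ ≤ (C + 1) * (ε / (C + 1)) := by gcongr
          _ = ε := ENNReal.mul_div_cancel (by simp) (by finiteness)

/-- The second moment of a weighted sum of conditionally centered variables. -/
theorem lintegral_weights_mul_sq (hW : IsProbabilityWeights W)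
    {κ : Kernel (Euc k) (Euc d)} [IsMarkovKernel κ]
    {h : Euc k × Euc d → ℝ} (hh : Measurable h) (hh1 : ∀ z, |h z| ≤ 1)
    (h0 : ∀ x, ∫ y, h (x, y) ∂(κ x) = 0) {n : ℕ} (hn : 1 ≤ n) :
    ∫⁻ z, ENNReal.ofReal ((∑ i, W n i z.1.1 (fun j => (z.2 j).1) * h (z.2 i)) ^ 2)
      ∂(sampleLaw (μ ⊗ₘ κ) n) =
    ∫⁻ z, ENNReal.ofReal (∑ i, W n i z.1.1 (fun j => (z.2 j).1) ^ 2 * h (z.2 i) ^ 2)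
      ∂(sampleLaw (μ ⊗ₘ κ) n) := by
  have hWm := hW.measurable n hn
  rw [sampleLaw, lintegral_prod _ (by fun_prop), lintegral_prod _ (by fun_prop)]
  -- Once the new observation is fixed, the weights are bounded functions of the sample covariates
  -- alone.
  refine lintegral_congr fun w => ?_
  have hWw := fun i => hW.measurable_right hn i w.1
  have habs : ∀ i xs, |W n i w.1 xs| ≤ 1 := fun i xs => by
    rw [abs_of_nonneg (hW.nonneg n hn _ _ _)]; exact hW.le_one hn _ _ _
  have hterm : ∀ (s : Fin n → Euc k × Euc d) i, |W n i w.1 (fun j => (s j).1) * h (s i)| ≤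
      W n i w.1 fun j => (s j).1 := fun s i => by
    rw [abs_mul, abs_of_nonneg (hW.nonneg n hn _ _ _)]
    exact mul_le_of_le_one_right (hW.nonneg n hn _ _ _) (hh1 _)
  rw [← ofReal_integral_eq_lintegral_ofReal (integrable_of_measurable_of_abs_le (by fun_prop)
    (c := 1) fun s => ?_) (Eventually.of_forall fun s => sq_nonneg _),
    integral_pi_sum_sq hWw habs hh hh1 h0, ofReal_integral_eq_lintegral_ofReal
      (integrable_of_measurable_of_abs_le (by fun_prop) (c := 1) fun s => ?_)
      (Eventually.of_forall fun s => Finset.sum_nonneg fun i _ => by positivity)]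
  · rw [abs_of_nonneg (Finset.sum_nonneg fun i _ => by positivity),
      ← hW.sum_eq_one n hn w.1 fun j => (s j).1]
    refine Finset.sum_le_sum fun i _ => ?_
    rw [← mul_pow, ← sq_abs, sq]
    exact (mul_le_of_le_one_right (abs_nonneg _) ((hterm s i).trans (hW.le_one hn _ _ _))).trans
      (hterm s i)
  · rw [abs_of_nonneg (sq_nonneg _)]
    refine (sq_le_one_iff_abs_le_one _).2 ((Finset.abs_sum_le_sum_abs _ _).trans ?_)
    rw [← hW.sum_eq_one n hn w.1 fun j => (s j).1]
    exact Finset.sum_le_sum fun i _ => hterm s i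

/-- The variance term. -/
theorem tendsto_lintegral_weights_mul (hW : IsProbabilityWeights W) (hS : StoneConditions μ W)
    {κ : Kernel (Euc k) (Euc d)} [IsMarkovKernel κ]
    {h : Euc k × Euc d → ℝ} (hh : Measurable h) (hh1 : ∀ z, |h z| ≤ 1)
    (h0 : ∀ x, ∫ y, h (x, y) ∂(κ x) = 0) :
    Tendsto (fun n : ℕ => ∫⁻ z, ‖∑ i, W n i z.1.1 (fun j => (z.2 j).1) * h (z.2 i)‖ₑ
      ∂(sampleLaw (μ ⊗ₘ κ) n)) atTop (𝓝 0) := by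
  have hmax : Tendsto (fun n : ℕ => ∫⁻ z, ENNReal.ofReal (⨆ i : Fin n, W n i z.1 z.2)
      ∂(sampleLaw μ n)) atTop (𝓝 0) := by
    refine tendsto_lintegral_ofReal_of_tendsto_measure _ ?_ hS.max_weight
    filter_upwards [eventually_ge_atTop 1] with n hn z
    have : Nonempty (Fin n) := ⟨⟨0, hn⟩⟩
    exact ciSup_le fun i => hW.le_one hn i _ _
  have hfst : MeasurePreserving (Prod.fst : Euc k × Euc d → Euc k) (μ ⊗ₘ κ) μ :=
    ⟨measurable_fst, Measure.fst_compProd μ κ⟩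
  refine tendsto_zero_of_forall_eventually_le_add fun ε hε => ?_
  obtain ⟨η, hη, hηε⟩ := exists_pos_ofReal_le hε
  have hlim := ENNReal.Tendsto.const_mul (a := ENNReal.ofReal η⁻¹) hmax
    (Or.inr ENNReal.ofReal_ne_top)
  rw [mul_zero] at hlim
  refine ⟨_, hlim, ?_⟩
  filter_upwards [eventually_ge_atTop 1] with n hn
  have hWm := hW.measurable n hn
  have hWm' := hW.measurable_sample (d := d) hn
  have hsup : Measurable fun z : Euc k × (Fin n → Euc k) => ⨆ i : Fin n, W n i z.1 z.2 :=
    Measurable.iSup hWm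
  have hsq : ∫⁻ z, ENNReal.ofReal ((∑ i, W n i z.1.1 (fun j => (z.2 j).1) * h (z.2 i)) ^ 2)
      ∂(sampleLaw (μ ⊗ₘ κ) n) ≤
      ∫⁻ z, ENNReal.ofReal (⨆ i : Fin n, W n i z.1 z.2) ∂(sampleLaw μ n) := by
    rw [← (measurePreserving_sampleLaw hfst n).lintegral_comp (by fun_prop),
      lintegral_weights_mul_sq hW hh hh1 h0 hn]
    refine lintegral_mono fun z => ENNReal.ofReal_le_ofReal ?_
    calc ∑ i, W n i z.1.1 (fun j => (z.2 j).1) ^ 2 * h (z.2 i) ^ 2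
        ≤ ∑ i, W n i z.1.1 (fun j => (z.2 j).1) * ⨆ i : Fin n, W n i z.1.1 fun j => (z.2 j).1 := by
          refine Finset.sum_le_sum fun i _ => ?_
          refine (mul_le_of_le_one_right (sq_nonneg _) ((sq_le_one_iff_abs_le_one _).2
            (hh1 _))).trans ?_
          rw [sq]
          exact mul_le_mul_of_nonneg_left (le_ciSup (f := fun i : Fin n => W n i z.1.1 _)
            (Set.finite_range _).bddAbove i) (hW.nonneg n hn _ _ _)
      _ = _ := by rw [← Finset.sum_mul, hW.sum_eq_one n hn, one_mul]
  calc ∫⁻ z, ‖∑ i, W n i z.1.1 (fun j => (z.2 j).1) * h (z.2 i)‖ₑ ∂(sampleLaw (μ ⊗ₘ κ) n)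
      ≤ ∫⁻ z, ε + ENNReal.ofReal η⁻¹ * ENNReal.ofReal
          ((∑ i, W n i z.1.1 (fun j => (z.2 j).1) * h (z.2 i)) ^ 2) ∂(sampleLaw (μ ⊗ₘ κ) n) := by
        refine lintegral_mono fun z => ?_
        set t := ∑ i, W n i z.1.1 (fun j => (z.2 j).1) * h (z.2 i)
        rw [Real.enorm_eq_ofReal_abs, ← ENNReal.ofReal_mul (by positivity)]
        -- Either `|t| ≤ η` or `|t| ≤ t ^ 2 / η`; this passes from the second moment to the first.
        have : |t| ≤ η + η⁻¹ * t ^ 2 := by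
          rw [← sq_abs t, inv_mul_eq_div, ← sub_le_iff_le_add', le_div_iff₀ hη]
          nlinarith [sq_nonneg (|t| - η), abs_nonneg t, sq_nonneg (|t|)]
        refine (ENNReal.ofReal_le_ofReal this).trans ?_
        rw [ENNReal.ofReal_add hη.le (by positivity)]
        gcongr
    _ ≤ _ := by
        rw [lintegral_add_left measurable_const, lintegral_const, measure_univ, mul_one,
          lintegral_const_mul _ (by fun_prop)]
        gcongr

/-- Convergence in mean of the weighted empirical measure of a fixed set. -/
theorem tendsto_lintegral_weightedEmpirical_apply (hW : IsProbabilityWeights W)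
    (hS : StoneConditions μ W) {κ : Kernel (Euc k) (Euc d)} [IsMarkovKernel κ]
    {B : Set (Euc d)} (hB : MeasurableSet B) :
    Tendsto (fun n : ℕ => ∫⁻ z, ((weightedEmpirical W z.2 z.1.1 B - κ z.1.1 B)
      + (κ z.1.1 B - weightedEmpirical W z.2 z.1.1 B)) ∂(sampleLaw (μ ⊗ₘ κ) n))
      atTop (𝓝 0) := by
  have hfst : MeasurePreserving (Prod.fst : Euc k × Euc d → Euc k) (μ ⊗ₘ κ) μ :=
    ⟨measurable_fst, Measure.fst_compProd μ κ⟩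
  set m : Euc k → ℝ := fun x => (κ x).real B with hm_def
  have hm : Measurable m := (κ.measurable_coe hB).ennreal_toReal
  have hm0 : ∀ x, 0 ≤ m x := fun x => measureReal_nonneg
  have hm1 : ∀ x, m x ≤ 1 := fun x => measureReal_le_one
  set h : Euc k × Euc d → ℝ := fun z => B.indicator 1 z.2 - m z.1 with hh_def
  have hh : Measurable h :=
    ((measurable_one.indicator hB).comp measurable_snd).sub (hm.comp measurable_fst)
  have hind : ∀ y, 0 ≤ B.indicator (1 : Euc d → ℝ) y ∧ B.indicator (1 : Euc d → ℝ) y ≤ 1 :=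
    fun y => ⟨Set.indicator_nonneg (fun _ _ => zero_le_one) _,
      Set.indicator_le_self' (fun _ _ => zero_le_one) _⟩
  have hh1 : ∀ z, |h z| ≤ 1 := fun z => by
    rw [abs_le]
    constructor <;> linarith [hind z.2, hm0 z.1, hm1 z.1]
  have h0 : ∀ x, ∫ y, h (x, y) ∂(κ x) = 0 := by
    intro x
    simp only [hh_def]
    rw [integral_sub (integrable_of_measurable_of_abs_le (measurable_one.indicator hB) (c := 1)
      fun y => by rw [abs_of_nonneg (hind y).1]; exact (hind y).2) (integrable_const _),
      integral_indicator_one hB]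
    simp [hm_def]
  have hvar := tendsto_lintegral_weights_mul hW hS hh hh1 h0
  have hbias := tendsto_lintegral_weights_sub hW hS hm (M := 1) fun x => by
    rw [abs_of_nonneg (hm0 x)]; exact hm1 x
  have hlim := hvar.add hbias
  rw [add_zero] at hlim
  refine tendsto_of_tendsto_of_tendsto_of_le_of_le' tendsto_const_nhds hlim
    (Eventually.of_forall fun _ => zero_le) ?_
  filter_upwards [eventually_ge_atTop 1] with n hn
  have hWm := hW.measurable n hn
  have hWm' := hW.measurable_sample (d := d) hn
  rw [← (measurePreserving_sampleLaw hfst n).lintegral_comp (by fun_prop),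
    ← lintegral_add_left (by fun_prop)]
  refine lintegral_mono fun z => ?_
  have := hW.isProbabilityMeasure_weightedEmpirical hn z.2 z.1.1
  rw [← enorm_toReal_sub_toReal (measure_ne_top _ _) (measure_ne_top _ _)]
  have hF : (weightedEmpirical W z.2 z.1.1 B).toReal =
      ∑ i, W n i z.1.1 (fun j => (z.2 j).1) * B.indicator 1 (z.2 i).2 := by
    rw [weightedEmpirical_apply _ _ hB, ENNReal.toReal_sum fun i _ => ?_]
    · refine Finset.sum_congr rfl fun i _ => ?_
      rw [ENNReal.toReal_mul, ENNReal.toReal_ofReal (hW.nonneg n hn _ _ _)]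
      by_cases hi : (z.2 i).2 ∈ B <;> simp [hi]
    · by_cases hi : (z.2 i).2 ∈ B <;> simp [hi]
  -- Variance plus bias; the weights sum to one, so `m X` can be moved inside the average.
  have hdecomp : (weightedEmpirical W z.2 z.1.1 B).toReal - (κ z.1.1 B).toReal =
      (∑ i, W n i z.1.1 (fun j => (z.2 j).1) * h (z.2 i)) +
        ∑ i, W n i z.1.1 (fun j => (z.2 j).1) * (m (z.2 i).1 - m z.1.1) := by
    rw [hF, ← Finset.sum_add_distrib]
    have : (κ z.1.1 B).toReal = ∑ i, W n i z.1.1 (fun j => (z.2 j).1) * m z.1.1 := by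
      rw [← Finset.sum_mul, hW.sum_eq_one n hn, one_mul]; rfl
    rw [this, ← Finset.sum_sub_distrib]
    refine Finset.sum_congr rfl fun i _ => ?_
    simp only [hh_def]; ring
  rw [hdecomp]
  refine (enorm_add_le _ _).trans ?_
  gcongr
  refine (enorm_sum_le _ _).trans (Finset.sum_le_sum fun i _ => ?_)
  rw [enorm_mul, Real.enorm_of_nonneg (hW.nonneg n hn _ _ _)]

end Stone

/-- Up to a set of small measure, a separable metric space is a finite disjoint union of measurable
sets of small diameter. -/
theorem exists_finite_disjoint_balls {E : Type*} [PseudoMetricSpace E]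
    [TopologicalSpace.SeparableSpace E] [MeasurableSpace E] [OpensMeasurableSpace E]
    (ν : Measure E) [IsFiniteMeasure ν] {r : ℝ} (hr : 0 < r) {ε : ℝ≥0∞} (hε : 0 < ε) :
    ∃ (N : ℕ) (B : Fin N → Set E), (∀ j, MeasurableSet (B j)) ∧
      Pairwise (Function.onFun Disjoint B) ∧ (∀ j, ∃ c, B j ⊆ Metric.ball c r) ∧
      ν (⋃ j, B j)ᶜ ≤ ε := by
  rcases isEmpty_or_nonempty E with hE | hE
  · exact ⟨0, Fin.elim0, fun j => j.elim0, fun j => j.elim0, fun j => j.elim0, by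
      simp [Measure.eq_zero_of_isEmpty ν]⟩
  let s : ℕ → Set E := fun j => Metric.ball (TopologicalSpace.denseSeq E j) r
  have hs : ∀ j, MeasurableSet (disjointed s j) := fun j =>
    MeasurableSet.disjointed (fun _ => Metric.isOpen_ball.measurableSet) j
  have hcov : ⋃ j, disjointed s j = Set.univ := by
    rw [iUnion_disjointed]
    refine Set.eq_univ_of_forall fun x => ?_
    obtain ⟨j, hy⟩ := (TopologicalSpace.denseRange_denseSeq E).exists_mem_open
      (Metric.isOpen_ball (x := x) (ε := r)) ⟨x, Metric.mem_ball_self hr⟩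
    exact Set.mem_iUnion.2 ⟨_, Metric.mem_ball_comm.1 hy⟩
  -- The uncovered sets decrease to the empty set, so their measures vanish by continuity from
  -- above.
  let D : ℕ → Set E := fun N => (⋃ j : Fin N, disjointed s j)ᶜ
  have hD : Tendsto (fun N => ν (D N)) atTop (𝓝 (ν (⋂ N, D N))) := by
    refine tendsto_measure_iInter_atTop (fun N => ?_) (fun M N hMN => ?_) ⟨0, measure_ne_top _ _⟩
    · exact (MeasurableSet.iUnion fun j => hs _).compl.nullMeasurableSet
    · exact Set.compl_subset_compl.2 (Set.iUnion_subset fun j =>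
        Set.subset_iUnion_of_subset (Fin.castLE hMN j) subset_rfl)
  have h0 : ⋂ N, D N = ∅ := by
    rw [Set.eq_empty_iff_forall_notMem]
    intro x hx
    obtain ⟨j, hj⟩ := Set.mem_iUnion.1 (hcov ▸ Set.mem_univ x)
    -- The set of index `j` is the last of the first `j + 1`.
    exact Set.mem_iInter.1 hx (j + 1) (Set.mem_iUnion.2 ⟨Fin.last j, hj⟩)
  rw [h0, measure_empty] at hD
  obtain ⟨N, hN⟩ := (ENNReal.tendsto_nhds_zero.1 hD ε hε).exists
  exact ⟨N, fun j => disjointed s j, fun j => hs j,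
    fun i j hij => disjoint_disjointed s fun h => hij (Fin.ext h),
    fun j => ⟨_, disjointed_subset s j⟩, hN⟩

/-! ### Stone's conditions imply consistency -/

section Forward

variable {k d : ℕ} {W : LocalWeights k} {μ : Measure (Euc k)} [IsProbabilityMeasure μ]

theorem tendsto_expectedError_of_stoneConditions (hW : IsProbabilityWeights W)
    (hS : StoneConditions μ W) {p : ℝ} (hp : 1 ≤ p) (P : Measure (Euc k × Euc d))
    [IsProbabilityMeasure P] (hP : P.fst = μ) (hPp : ∫⁻ z, ‖z.2‖ₑ ^ p ∂P < ∞) :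
    Tendsto (fun n : ℕ => expectedError W p P n) atTop (𝓝 0) := by
  have hp0 : 0 < p := by linarith
  obtain ⟨C, hC, hCb⟩ := hS.bounded
  obtain ⟨κ, hκM, hκ⟩ : ∃ κ : Kernel (Euc k) (Euc d), IsMarkovKernel κ ∧ κ = P.condKernel :=
    ⟨_, inferInstance, rfl⟩
  have hPκ : P = μ ⊗ₘ κ := by rw [hκ, ← hP, P.disintegrate]
  let G : Euc d → ℝ≥0∞ := fun y => 2 ^ (p - 1) * ‖y‖ₑ ^ p
  have hG : Measurable G := by fun_prop
  have h2 : (2 : ℝ≥0∞) ^ (p - 1) ≠ ∞ := ENNReal.rpow_ne_top_of_nonneg (by linarith) (by simp)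
  -- Finite by the moment assumption; `ν D` is the tail moment of `Y` over `D`, so covering up to
  -- small `ν`-measure controls the transport of the remainder.
  let ν : Measure (Euc d) := P.snd.withDensity G
  have hνfin : IsFiniteMeasure ν := by
    refine isFiniteMeasure_withDensity ?_
    rw [Measure.snd, lintegral_map hG measurable_snd]
    simp only [G]
    rw [lintegral_const_mul _ (by fun_prop)]
    exact ENNReal.mul_ne_top h2 hPp.ne
  refine tendsto_zero_of_forall_eventually_le_add fun ε hε => ?_
  have hε2 := ENNReal.half_pos hε.ne'
  obtain ⟨η, hη, hηε⟩ := exists_pos_ofReal_le hε2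
  -- The tail appears for `F̂` with factor `C` and for `F_X` with factor `1`.
  have hε3 : 0 < ε / 2 / (C + 1) := ENNReal.div_pos hε2.ne' (by finiteness)
  -- Cells in balls of radius `η ^ (1 / p) / 2` have diameter at most `η ^ (1 / p)`, hence cost at
  -- most `η`.
  obtain ⟨N, B, hB, hBd, hBball, hBν⟩ := exists_finite_disjoint_balls ν
    (half_pos (Real.rpow_pos_of_pos hη (1 / p))) hε3
  have hδ : ∀ j, ∀ x ∈ B j, ∀ y ∈ B j, ‖x - y‖ₑ ^ p ≤ ε / 2 := by
    intro j x hx y hy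
    obtain ⟨c, hc⟩ := hBball j
    have hxy : ‖x - y‖ ≤ η ^ (1 / p) := by
      have h1 := Metric.mem_ball.1 (hc hx)
      have h2 := Metric.mem_ball.1 (hc hy)
      rw [← dist_eq_norm]
      linarith [dist_triangle_right x y c]
    refine le_trans ?_ hηε
    rw [← ofReal_norm, ENNReal.ofReal_rpow_of_nonneg (norm_nonneg _) hp0.le]
    refine ENNReal.ofReal_le_ofReal ((Real.rpow_le_rpow (norm_nonneg _) hxy hp0.le).trans_eq ?_)
    rw [← Real.rpow_mul hη.le, one_div_mul_cancel hp0.ne', Real.rpow_one]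
  obtain ⟨R, hRtop, hR⟩ : ∃ R : ℝ≥0∞, R ≠ ∞ ∧ ∀ j, ∀ x ∈ B j, G x ≤ R := by
    have : ∀ j, ∃ R : ℝ≥0∞, R ≠ ∞ ∧ ∀ x ∈ B j, G x ≤ R := by
      intro j
      obtain ⟨c, hc⟩ := hBball j
      refine ⟨2 ^ (p - 1) * ENNReal.ofReal (‖c‖ + η ^ (1 / p) / 2) ^ p,
        ENNReal.mul_ne_top h2 (ENNReal.rpow_ne_top_of_nonneg hp0.le ENNReal.ofReal_ne_top),
        fun x hx => ?_⟩
      simp only [G]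
      gcongr
      rw [← ofReal_norm]
      refine ENNReal.ofReal_le_ofReal ?_
      have h1 := Metric.mem_ball.1 (hc hx)
      rw [dist_eq_norm] at h1
      linarith [norm_le_norm_add_norm_sub' x c]
    choose R hR1 hR2 using this
    exact ⟨∑ j, R j, ENNReal.sum_ne_top.2 fun j _ => hR1 j, fun j x hx => (hR2 j x hx).trans
      (Finset.single_le_sum (f := R) (fun _ _ => zero_le) (Finset.mem_univ j))⟩
  set D := (⋃ j, B j)ᶜ
  have hDm : MeasurableSet D := (MeasurableSet.iUnion hB).compl
  -- the conditional tail moments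
  obtain ⟨g, hg, hgκ⟩ : ∃ g : Euc k → ℝ≥0∞, Measurable g ∧ ∀ x, ∫⁻ y in D, G y ∂(κ x) = g x := by
    refine ⟨fun x => ∫⁻ y, D.indicator G y ∂(κ x), ?_, fun x => (lintegral_indicator hDm _).symm⟩
    exact (hG.indicator hDm).lintegral_kernel
  have hgν : ∫⁻ x, g x ∂μ = ν D := by
    simp only [ν]
    rw [withDensity_apply _ hDm, ← lintegral_indicator hDm, hPκ, Measure.snd,
      lintegral_map (hG.indicator hDm) measurable_snd,
      Measure.lintegral_compProd (f := fun a => D.indicator G a.2)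
        ((hG.indicator hDm).comp measurable_snd)]
    refine lintegral_congr fun x => ?_
    rw [← hgκ, lintegral_indicator hDm]
  let e : ℕ → Fin N → ℝ≥0∞ := fun n j =>
    ∫⁻ z, ((weightedEmpirical W z.2 z.1.1 (B j) - κ z.1.1 (B j))
      + (κ z.1.1 (B j) - weightedEmpirical W z.2 z.1.1 (B j))) ∂(sampleLaw (μ ⊗ₘ κ) n)
  have hlim : Tendsto (fun n => ∑ j, R * e n j) atTop (𝓝 0) := by
    have := tendsto_finsetSum (Finset.univ : Finset (Fin N)) fun j _ =>
      ENNReal.Tendsto.const_mul (a := R)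
        (tendsto_lintegral_weightedEmpirical_apply hW hS (κ := κ) (hB j)) (Or.inr hRtop)
    simpa using this
  refine ⟨_, hlim, ?_⟩
  filter_upwards [eventually_ge_atTop 1] with n hn
  have hWm' := hW.measurable_sample (d := d) hn
  have hWm := hW.measurable n hn
  have hFm : ∀ {A : Set (Euc d)}, MeasurableSet A →
      Measurable fun z : (Euc k × Euc d) × (Fin n → Euc k × Euc d) =>
        weightedEmpirical W z.2 z.1.1 A := by
    intro A hA
    simp only [weightedEmpirical_apply _ _ hA]
    refine Finset.measurable_sum _ fun i _ => (hWm' i).ennreal_ofReal.mul ?_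
    exact (measurable_one.indicator hA).comp (by fun_prop)
  have hκm : ∀ {A : Set (Euc d)}, MeasurableSet A →
      Measurable fun z : (Euc k × Euc d) × (Fin n → Euc k × Euc d) => κ z.1.1 A :=
    fun hA => (κ.measurable_coe hA).comp (by fun_prop)
  have hem : ∀ j, Measurable fun z : (Euc k × Euc d) × (Fin n → Euc k × Euc d) =>
      R * ((weightedEmpirical W z.2 z.1.1 (B j) - κ z.1.1 (B j))
      + (κ z.1.1 (B j) - weightedEmpirical W z.2 z.1.1 (B j))) := fun j =>
    (((hFm (hB j)).sub (hκm (hB j))).add ((hκm (hB j)).sub (hFm (hB j)))).const_mul R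
  have htail : ∫⁻ z, ∫⁻ y in D, G y ∂(weightedEmpirical W z.2 z.1.1) ∂(sampleLaw (μ ⊗ₘ κ) n)
      ≤ C * ν D := by
    have hu : Measurable fun w : Euc k × Euc d => D.indicator G w.2 :=
      (hG.indicator hDm).comp measurable_snd
    simp_rw [← lintegral_indicator hDm, lintegral_weightedEmpirical]
    rw [lintegral_sampleLaw_sum_mul (a := fun i z => ENNReal.ofReal (W n i z.1 z.2))
      (fun i => (hWm i).ennreal_ofReal) hu, ← hgν]
    simp_rw [lintegral_indicator hDm, hgκ]
    exact lintegral_weights_le hC hCb hn hg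
  have htail' : ∫⁻ z, ∫⁻ y in D, G y ∂(κ z.1.1) ∂(sampleLaw (μ ⊗ₘ κ) n) = ν D := by
    simp_rw [hgκ]
    rw [← hgν, (measurePreserving_fst_sampleLaw (μ ⊗ₘ κ) n).lintegral_comp
      (f := fun w => g w.1) (by fun_prop), Measure.lintegral_compProd (by fun_prop)]
    simp
  have hgm : Measurable fun z : (Euc k × Euc d) × (Fin n → Euc k × Euc d) =>
      ∫⁻ y in D, G y ∂(κ z.1.1) := by
    simp_rw [hgκ]; fun_prop
  calc expectedError W p P n
      = ∫⁻ z, wassersteinDist p (weightedEmpirical W z.2 z.1.1) (κ z.1.1) ^ p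
          ∂(sampleLaw (μ ⊗ₘ κ) n) := by rw [expectedError, ← hκ, hPκ]
    _ ≤ ∫⁻ z, (ε / 2 + ((∑ j, R * ((weightedEmpirical W z.2 z.1.1 (B j) - κ z.1.1 (B j))
          + (κ z.1.1 (B j) - weightedEmpirical W z.2 z.1.1 (B j))))
          + ∫⁻ y in D, G y ∂(weightedEmpirical W z.2 z.1.1) + ∫⁻ y in D, G y ∂(κ z.1.1)))
          ∂(sampleLaw (μ ⊗ₘ κ) n) := by
        -- Only monotonicity is applied to the Wasserstein integrand, so its measurability plays no
        -- role.
        refine lintegral_mono fun z => ?_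
        have := hW.isProbabilityMeasure_weightedEmpirical hn z.2 z.1.1
        exact wassersteinDist_rpow_le_of_partition hp hB hBd hδ hR _ _
    _ ≤ ε / 2 + (∑ j, R * e n j + C * ν D + ν D) := by
        rw [lintegral_add_left measurable_const, lintegral_const, measure_univ, mul_one,
          lintegral_add_right _ hgm, htail',
          lintegral_add_left (Finset.measurable_sum _ fun j _ => hem j),
          lintegral_finsetSum _ fun j _ => hem j]
        gcongr with j
        rw [lintegral_const_mul' _ _ hRtop]
    _ = ε / 2 + (C + 1) * ν D + ∑ j, R * e n j := by ring
    _ ≤ ε + ∑ j, R * e n j := by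
        gcongr
        calc ε / 2 + (C + 1) * ν D ≤ ε / 2 + (C + 1) * (ε / 2 / (C + 1)) := by gcongr
          _ = ε := by rw [ENNReal.mul_div_cancel (by simp) (by finiteness), ENNReal.add_halves]

end Forward

/-! ### Consistency implies Stone's conditions -/

section Converse

variable {k d : ℕ} {W : LocalWeights k} {μ : Measure (Euc k)} [IsProbabilityMeasure μ]

/-- The expected error for a law which is given by its conditional distributions. -/
theorem expectedError_compProd (W : LocalWeights k) (p : ℝ) (κ : Kernel (Euc k) (Euc d))
    [IsMarkovKernel κ] (n : ℕ) :
    expectedError W p (μ ⊗ₘ κ) n =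
      ∫⁻ z, wassersteinDist p (weightedEmpirical W z.2 z.1.1) (κ z.1.1) ^ p
        ∂(sampleLaw (μ ⊗ₘ κ) n) := by
  -- The conditional kernel agrees with `κ` only almost everywhere, which suffices because `X` has
  -- law `μ`.
  have h := eq_condKernel_of_measure_eq_compProd (ρ := μ ⊗ₘ κ) κ (by rw [Measure.fst_compProd])
  rw [Measure.fst_compProd] at h
  have hfst : MeasurePreserving (Prod.fst : Euc k × Euc d → Euc k) (μ ⊗ₘ κ) μ :=
    ⟨measurable_fst, Measure.fst_compProd μ κ⟩
  have hae := (hfst.comp (measurePreserving_fst_sampleLaw (μ ⊗ₘ κ) n)).quasiMeasurePreserving.ae h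
  refine lintegral_congr_ae ?_
  filter_upwards [hae] with z hz
  simp only [Function.comp_apply] at hz
  rw [hz]

theorem measurePreserving_graph {g : Euc k → Euc d} (hg : Measurable g) :
    MeasurePreserving (fun x => (x, g x)) μ (μ ⊗ₘ Kernel.deterministic g hg) :=
  ⟨by fun_prop, (Measure.compProd_deterministic hg).symm⟩

/-- The error for a response which is a function of the covariate. -/
theorem lintegral_weights_le_expectedError (hW : IsProbabilityWeights W) {p : ℝ} (hp : 1 ≤ p)
    {g : Euc k → Euc d} (hg : Measurable g) {n : ℕ} (hn : 1 ≤ n) :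
    ∫⁻ z, ∑ i, ENNReal.ofReal (W n i z.1 z.2) * ‖g (z.2 i) - g z.1‖ₑ ^ p ∂(sampleLaw μ n) ≤
      expectedError W p (μ ⊗ₘ Kernel.deterministic g hg) n := by
  have hWm := hW.measurable n hn
  have hWm' := hW.measurable_sample (d := d) hn
  calc ∫⁻ z, ∑ i, ENNReal.ofReal (W n i z.1 z.2) * ‖g (z.2 i) - g z.1‖ₑ ^ p ∂(sampleLaw μ n)
      = ∫⁻ z, ∑ i, ENNReal.ofReal (W n i z.1.1 fun j => (z.2 j).1) *
          ‖(z.2 i).2 - g z.1.1‖ₑ ^ p ∂(sampleLaw (μ ⊗ₘ Kernel.deterministic g hg) n) :=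
        (measurePreserving_sampleLaw (measurePreserving_graph hg) n).lintegral_comp
          (f := fun z : (Euc k × Euc d) × (Fin n → Euc k × Euc d) =>
            ∑ i, ENNReal.ofReal (W n i z.1.1 fun j => (z.2 j).1) *
              ‖(z.2 i).2 - g z.1.1‖ₑ ^ p) (by fun_prop)
    _ ≤ _ := by
        rw [expectedError_compProd]
        refine lintegral_mono fun z => ?_
        rw [Kernel.deterministic_apply]
        refine le_trans (le_of_eq ?_)
          (lintegral_le_wassersteinDist_dirac (by linarith) (weightedEmpirical W z.2 z.1.1) _)
        rw [lintegral_weightedEmpirical]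

/-- Consistency for responses which are functions of the covariate. -/
theorem tendsto_expectedError_deterministic {p : ℝ}
    (h : ∀ (P : Measure (Euc k × Euc d)) [IsProbabilityMeasure P],
        P.fst = μ → ∫⁻ z, ‖z.2‖ₑ ^ p ∂P < ∞ →
        Tendsto (fun n : ℕ => expectedError W p P n) atTop (𝓝 0))
    {g : Euc k → Euc d} (hg : Measurable g) (hgp : ∫⁻ x, ‖g x‖ₑ ^ p ∂μ < ∞) :
    Tendsto (fun n : ℕ => expectedError W p (μ ⊗ₘ Kernel.deterministic g hg) n) atTop (𝓝 0) := by
  refine h _ (Measure.fst_compProd _ _) ?_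
  rwa [← (measurePreserving_graph hg).lintegral_comp (f := fun z => ‖z.2‖ₑ ^ p) (by fun_prop)]

/-- Consistency implies Stone's localization condition. -/
theorem tendsto_local_mass_of_tendsto_expectedError (hd : 1 ≤ d) (hW : IsProbabilityWeights W)
    {p : ℝ} (hp : 1 ≤ p)
    (h : ∀ (P : Measure (Euc k × Euc d)) [IsProbabilityMeasure P],
        P.fst = μ → ∫⁻ z, ‖z.2‖ₑ ^ p ∂P < ∞ →
        Tendsto (fun n : ℕ => expectedError W p P n) atTop (𝓝 0)) {ε : ℝ} (hε : 0 < ε) {η : ℝ}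
    (hη : 0 < η) :
    Tendsto (fun n : ℕ => sampleLaw μ n
      {z | η < ∑ i, W n i z.1 z.2 * Set.indicator {x : Euc k | ε < ‖x - z.1‖} 1 (z.2 i)})
      atTop (𝓝 0) := by
  have hp0 : 0 < p := by linarith
  obtain ⟨e, he⟩ : ∃ e : Euc d, ‖e‖ₑ = 1 :=
    ⟨EuclideanSpace.single ⟨0, hd⟩ 1, by rw [← ofReal_norm]; simp⟩
  refine tendsto_measure_of_tendsto_lintegral_ofReal (fun n => sampleLaw μ n) ?_ ?_ hη
  · filter_upwards [eventually_ge_atTop 1] with n hn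
    refine Finset.measurable_sum _ fun i _ => (hW.measurable n hn i).mul ?_
    exact (measurable_one (α := ℝ)).indicator
      (s := {z : Euc k × (Fin n → Euc k) | ε < ‖z.2 i - z.1‖})
      (measurableSet_lt (by fun_prop) (by fun_prop))
  refine tendsto_zero_of_forall_eventually_le_add fun δ hδ => ?_
  -- With radius `ε / 2`, two points more than `ε` apart never share a cell.
  obtain ⟨N, B, hB, -, hball, hBμ⟩ := exists_finite_disjoint_balls μ (half_pos hε) hδ
  have hgm : ∀ j, Measurable ((B j).indicator fun _ => e) := fun j =>
    measurable_const.indicator (hB j)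
  have hgp : ∀ j, ∫⁻ x, ‖(B j).indicator (fun _ => e) x‖ₑ ^ p ∂μ < ∞ := by
    intro j
    refine lt_of_le_of_lt (lintegral_mono (g := fun _ => 1) fun x => ?_) (by simp)
    by_cases hx : x ∈ B j <;> simp [hx, he, hp0]
  have hlim : Tendsto (fun n => ∑ j, ∫⁻ z, ∑ i, ENNReal.ofReal (W n i z.1 z.2) *
      ‖(B j).indicator (fun _ => e) (z.2 i) - (B j).indicator (fun _ => e) z.1‖ₑ ^ p
      ∂(sampleLaw μ n)) atTop (𝓝 0) := by
    have := tendsto_finsetSum (Finset.univ : Finset (Fin N)) fun j _ =>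
      tendsto_expectedError_deterministic h (hgm j) (hgp j)
    rw [Finset.sum_const_zero] at this
    refine tendsto_of_tendsto_of_tendsto_of_le_of_le' tendsto_const_nhds this
      (Eventually.of_forall fun _ => zero_le) ?_
    filter_upwards [eventually_ge_atTop 1] with n hn
    exact Finset.sum_le_sum fun j _ => lintegral_weights_le_expectedError hW hp (hgm j) hn
  refine ⟨_, hlim, ?_⟩
  filter_upwards [eventually_ge_atTop 1] with n hn
  have hWm := hW.measurable n hn
  have hDm : MeasurableSet (⋃ j, B j)ᶜ := (MeasurableSet.iUnion hB).compl
  -- If `X` lies in `B j` and `X_i` is far from `X`, then `X_i` is outside `B j` and the `j`-th term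
  -- equals `1`.
  have hpt : ∀ (z : Euc k × (Fin n → Euc k)) i,
      ENNReal.ofReal ({x : Euc k | ε < ‖x - z.1‖}.indicator 1 (z.2 i)) ≤
      (⋃ j, B j)ᶜ.indicator 1 z.1 + ∑ j,
        ‖(B j).indicator (fun _ => e) (z.2 i) - (B j).indicator (fun _ => e) z.1‖ₑ ^ p := by
    intro z i
    by_cases hz : ε < ‖z.2 i - z.1‖
    · rw [Set.indicator_of_mem (by exact hz), Pi.one_apply, ENNReal.ofReal_one]
      by_cases hz1 : z.1 ∈ ⋃ j, B j
      · obtain ⟨j, hj⟩ := Set.mem_iUnion.1 hz1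
        have hj' : z.2 i ∉ B j := by
          intro hj'
          obtain ⟨c, hc⟩ := hball j
          have h1 := Metric.mem_ball.1 (hc hj)
          have h2 := Metric.mem_ball.1 (hc hj')
          rw [← dist_eq_norm] at hz
          linarith [dist_triangle_right (z.2 i) z.1 c]
        refine le_trans ?_ le_add_self
        refine le_trans ?_ (Finset.single_le_sum (f := fun j => ‖(B j).indicator (fun _ => e) (z.2 i)
          - (B j).indicator (fun _ => e) z.1‖ₑ ^ p) (fun _ _ => zero_le) (Finset.mem_univ j))
        simp [hj, hj', he]
      · rw [Set.indicator_of_mem (by exact hz1)]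
        exact le_self_add
    · simp [Set.indicator_of_notMem (s := {x : Euc k | ε < ‖x - z.1‖}) (a := z.2 i) hz]
  calc ∫⁻ z, ENNReal.ofReal (∑ i, W n i z.1 z.2 *
        Set.indicator {x : Euc k | ε < ‖x - z.1‖} 1 (z.2 i)) ∂(sampleLaw μ n)
      ≤ ∫⁻ z, (⋃ j, B j)ᶜ.indicator 1 z.1 + ∑ j, ∑ i, ENNReal.ofReal (W n i z.1 z.2) *
        ‖(B j).indicator (fun _ => e) (z.2 i) - (B j).indicator (fun _ => e) z.1‖ₑ ^ p
          ∂(sampleLaw μ n) := by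
        refine lintegral_mono fun z => ?_
        rw [ENNReal.ofReal_sum_of_nonneg fun i _ => mul_nonneg (hW.nonneg n hn _ _ _)
          (Set.indicator_nonneg (f := (1 : Euc k → ℝ)) (fun _ _ => zero_le_one) _)]
        calc ∑ i, ENNReal.ofReal (W n i z.1 z.2 *
              Set.indicator {x : Euc k | ε < ‖x - z.1‖} 1 (z.2 i))
            ≤ ∑ i, ENNReal.ofReal (W n i z.1 z.2) * ((⋃ j, B j)ᶜ.indicator 1 z.1 + ∑ j,
              ‖(B j).indicator (fun _ => e) (z.2 i) -
                (B j).indicator (fun _ => e) z.1‖ₑ ^ p) := by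
              gcongr with i
              rw [ENNReal.ofReal_mul (hW.nonneg n hn _ _ _)]
              gcongr
              exact hpt z i
          _ = _ := by
              simp_rw [mul_add, Finset.sum_add_distrib]
              rw [← Finset.sum_mul, hW.sum_ofReal hn, one_mul, Finset.sum_comm]
              simp_rw [Finset.mul_sum]
    _ = μ (⋃ j, B j)ᶜ + ∑ j, ∫⁻ z, ∑ i, ENNReal.ofReal (W n i z.1 z.2) *
        ‖(B j).indicator (fun _ => e) (z.2 i) - (B j).indicator (fun _ => e) z.1‖ₑ ^ p
          ∂(sampleLaw μ n) := by
        rw [lintegral_add_left (f := fun z : Euc k × (Fin n → Euc k) => (⋃ j, B j)ᶜ.indicator 1 z.1)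
            ((measurable_one.indicator hDm).comp measurable_fst),
          (measurePreserving_fst_sampleLaw μ n).lintegral_comp (f := (⋃ j, B j)ᶜ.indicator 1)
            (measurable_one.indicator hDm), lintegral_indicator_one hDm,
          lintegral_finsetSum _ fun j _ => ?_]
        have := hgm j
        fun_prop
    _ ≤ _ := by gcongr

/-- Consistency implies that the largest weight vanishes. -/
theorem tendsto_max_weight_of_tendsto_expectedError (hd : 1 ≤ d) (hW : IsProbabilityWeights W)
    {p : ℝ} (hp : 1 ≤ p)
    (h : ∀ (P : Measure (Euc k × Euc d)) [IsProbabilityMeasure P],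
        P.fst = μ → ∫⁻ z, ‖z.2‖ₑ ^ p ∂P < ∞ →
        Tendsto (fun n : ℕ => expectedError W p P n) atTop (𝓝 0)) {η : ℝ} (hη : 0 < η) :
    Tendsto (fun n : ℕ => sampleLaw μ n {z | η < ⨆ i : Fin n, W n i z.1 z.2}) atTop (𝓝 0) := by
  have hp0 : 0 < p := by linarith
  obtain ⟨e, he⟩ : ∃ e : Euc d, ‖e‖ = 1 := ⟨EuclideanSpace.single ⟨0, hd⟩ 1, by simp⟩
  have he' : ‖e‖ₑ = 1 := by rw [← ofReal_norm, he, ENNReal.ofReal_one]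
  -- responses which are independent of the covariates, and equal to `0` or `e` with the same
  -- probability
  let ν : Measure (Euc d) := (2⁻¹ : ℝ≥0∞) • (Measure.dirac 0 + Measure.dirac e)
  have hνint : ∀ f : Euc d → ℝ≥0∞, ∫⁻ y, f y ∂ν = 2⁻¹ * (f 0 + f e) := by
    intro f
    simp [ν, lintegral_smul_measure, lintegral_add_measure, mul_add]
  have hν : IsProbabilityMeasure ν := ⟨by
    rw [← lintegral_one, hνint, one_add_one_eq_two, ENNReal.inv_mul_cancel (by simp) (by simp)]⟩
  let κ : Kernel (Euc k) (Euc d) := Kernel.const _ ν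
  have hlim := h (μ ⊗ₘ κ) (Measure.fst_compProd _ _) (by
    rw [Measure.lintegral_compProd (by fun_prop)]
    simp [κ, hνint, he', hp0])
  -- A bounded nonexpansive function with `φ 0 = 0` and `φ e = 1`, so `φ(Y) - 1 / 2` is centered
  -- with values `±1 / 2`.
  let φ : Euc d → ℝ := fun y => min 1 ‖y‖
  have hφ : Measurable φ := by fun_prop
  have hφ0 : ∀ y, 0 ≤ φ y := fun y => le_min zero_le_one (norm_nonneg _)
  have hφ1 : ∀ y, φ y ≤ 1 := fun y => min_le_left _ _
  have hφL : ∀ x y, ENNReal.ofReal (φ x) ≤ ENNReal.ofReal (φ y) + ‖x - y‖ₑ := by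
    intro x y
    rw [← ofReal_norm, ← ENNReal.ofReal_add (hφ0 _) (norm_nonneg _)]
    refine ENNReal.ofReal_le_ofReal ?_
    have h1 := norm_le_norm_add_norm_sub' x y
    simp only [φ]
    rcases le_total 1 ‖y‖ with hy | hy
    · rw [min_eq_left hy]; exact (min_le_left _ _).trans (by linarith [norm_nonneg (x - y)])
    · rw [min_eq_right hy]; exact (min_le_right _ _).trans h1
  let f : Euc k × Euc d → ℝ := fun z => φ z.2 - 1 / 2
  have hf : Measurable f := by fun_prop
  have hf1 : ∀ z, |f z| ≤ 1 := fun z => by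
    simp only [f]; rw [abs_le]; constructor <;> linarith [hφ0 z.2, hφ1 z.2]
  have hf0 : ∀ x, ∫ y, f (x, y) ∂(κ x) = 0 := by
    intro x
    simp only [κ, Kernel.const_apply, ν, f]
    rw [integral_smul_measure, integral_add_measure (integrable_dirac' (by fun_prop) (by simp))
      (integrable_dirac' (by fun_prop) (by simp)), integral_dirac, integral_dirac]
    simp only [φ, norm_zero, he]
    norm_num
  have hfsq : ∀ x, ∫⁻ y, ENNReal.ofReal (f (x, y) ^ 2) ∂(κ x) = ENNReal.ofReal (1 / 4) := by
    intro x
    simp only [κ, Kernel.const_apply, hνint, f, φ, norm_zero, he]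
    norm_num
    rw [← two_mul, ← mul_assoc, ENNReal.inv_mul_cancel (by simp) (by simp), one_mul]
  have hfirst : Tendsto (fun n : ℕ => ∫⁻ z, ‖∑ i, W n i z.1.1 (fun j => (z.2 j).1) * f (z.2 i)‖ₑ
      ∂(sampleLaw (μ ⊗ₘ κ) n)) atTop (𝓝 0) := by
    refine tendsto_zero_of_forall_eventually_le_add fun ε hε => ?_
    obtain ⟨τ, hτ, hτε⟩ := exists_pos_ofReal_le hε
    have hτ0 : ENNReal.ofReal τ ≠ 0 := (ENNReal.ofReal_pos.2 hτ).ne'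
    have hτtop : ENNReal.ofReal τ ^ (1 - p) ≠ ∞ :=
      ENNReal.rpow_ne_top_of_ne_zero hτ0 ENNReal.ofReal_ne_top
    have hlim' := ENNReal.Tendsto.const_mul (a := ENNReal.ofReal τ ^ (1 - p)) hlim (Or.inr hτtop)
    rw [mul_zero] at hlim'
    refine ⟨_, hlim', ?_⟩
    filter_upwards [eventually_ge_atTop 1] with n hn
    calc ∫⁻ z, ‖∑ i, W n i z.1.1 (fun j => (z.2 j).1) * f (z.2 i)‖ₑ ∂(sampleLaw (μ ⊗ₘ κ) n)
        ≤ ∫⁻ z, ENNReal.ofReal τ + ENNReal.ofReal τ ^ (1 - p) *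
            wassersteinDist p (weightedEmpirical W z.2 z.1.1) ν ^ p
            ∂(sampleLaw (μ ⊗ₘ κ) n) := by
          refine lintegral_mono fun z => ?_
          have := hW.isProbabilityMeasure_weightedEmpirical hn z.2 z.1.1
          obtain ⟨h1, h2⟩ := lintegral_le_add_wassersteinDist hp
            (Q₁ := weightedEmpirical W z.2 z.1.1) (Q₂ := ν) hφ.ennreal_ofReal hφL hτ0
            ENNReal.ofReal_ne_top
          have hA : ∫⁻ y, ENNReal.ofReal (φ y) ∂(weightedEmpirical W z.2 z.1.1) =
              ENNReal.ofReal (∑ i, W n i z.1.1 (fun j => (z.2 j).1) * φ (z.2 i).2) := by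
            rw [lintegral_weightedEmpirical, ENNReal.ofReal_sum_of_nonneg fun i _ =>
              mul_nonneg (hW.nonneg n hn _ _ _) (hφ0 _)]
            exact Finset.sum_congr rfl fun i _ =>
              (ENNReal.ofReal_mul (hW.nonneg n hn _ _ _)).symm
          have hA0 : 0 ≤ ∑ i, W n i z.1.1 (fun j => (z.2 j).1) * φ (z.2 i).2 :=
            Finset.sum_nonneg fun i _ => mul_nonneg (hW.nonneg n hn _ _ _) (hφ0 _)
          have hν2 : ∫⁻ y, ENNReal.ofReal (φ y) ∂ν = ENNReal.ofReal (1 / 2) := by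
            rw [hνint]; simp [φ, he]
          have hS : ∑ i, W n i z.1.1 (fun j => (z.2 j).1) * f (z.2 i) =
              (∑ i, W n i z.1.1 (fun j => (z.2 j).1) * φ (z.2 i).2) - 1 / 2 := by
            simp only [f, mul_sub, Finset.sum_sub_distrib]
            rw [← Finset.sum_mul, hW.sum_eq_one n hn, one_mul]
          rw [hA, hν2, add_assoc] at h1 h2
          rw [hS, ← ENNReal.toReal_ofReal hA0,
            ← ENNReal.toReal_ofReal (by norm_num : (0 : ℝ) ≤ 1 / 2),
            enorm_toReal_sub_toReal ENNReal.ofReal_ne_top ENNReal.ofReal_ne_top]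
          rw [← tsub_le_iff_left] at h1 h2
          rcases le_total (ENNReal.ofReal (∑ i, W n i z.1.1 (fun j => (z.2 j).1) * φ (z.2 i).2))
            (ENNReal.ofReal (1 / 2)) with hle | hle
          · rw [tsub_eq_zero_of_le hle, zero_add]; exact h2
          · rw [tsub_eq_zero_of_le hle, add_zero]; exact h1
      _ ≤ ε + ENNReal.ofReal τ ^ (1 - p) * expectedError W p (μ ⊗ₘ κ) n := by
          rw [lintegral_add_left measurable_const, lintegral_const, measure_univ, mul_one,
            expectedError_compProd, lintegral_const_mul' _ _ hτtop]
          gcongr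
          exact le_rfl
  have hsq : Tendsto (fun n : ℕ => ∫⁻ z, ENNReal.ofReal ((⨆ i : Fin n, W n i z.1 z.2) ^ 2)
      ∂(sampleLaw μ n)) atTop (𝓝 0) := by
    -- The factor `4` compensates the variance `1 / 4` of `φ(Y)`.
    have hfirst' := ENNReal.Tendsto.const_mul (a := 4) hfirst (Or.inr (by simp))
    rw [mul_zero] at hfirst'
    refine tendsto_of_tendsto_of_tendsto_of_le_of_le' tendsto_const_nhds hfirst'
      (Eventually.of_forall fun _ => zero_le) ?_
    filter_upwards [eventually_ge_atTop 1] with n hn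
    have hWm := hW.measurable n hn
    have : Nonempty (Fin n) := ⟨⟨0, hn⟩⟩
    calc ∫⁻ z, ENNReal.ofReal ((⨆ i : Fin n, W n i z.1 z.2) ^ 2) ∂(sampleLaw μ n)
        ≤ ∫⁻ z, 4 * ∑ i, ENNReal.ofReal (W n i z.1 z.2 ^ 2) * ENNReal.ofReal (1 / 4)
            ∂(sampleLaw μ n) := by
          refine lintegral_mono fun z => ?_
          obtain ⟨i, hi⟩ := exists_eq_ciSup_of_finite (f := fun i : Fin n => W n i z.1 z.2)
          rw [← hi, ← Finset.sum_mul, mul_comm, mul_assoc]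
          have h4 : ENNReal.ofReal (1 / 4) * 4 = 1 := by
            rw [← ENNReal.ofReal_ofNat, ← ENNReal.ofReal_mul (by norm_num)]; norm_num
          rw [h4, mul_one]
          exact Finset.single_le_sum (f := fun i => ENNReal.ofReal (W n i z.1 z.2 ^ 2))
            (fun _ _ => zero_le) (Finset.mem_univ i)
      _ = 4 * ∫⁻ z, ENNReal.ofReal (∑ i, W n i z.1.1 (fun j => (z.2 j).1) ^ 2 * f (z.2 i) ^ 2)
            ∂(sampleLaw (μ ⊗ₘ κ) n) := by
          rw [lintegral_const_mul _ (by fun_prop)]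
          congr 1
          have := lintegral_sampleLaw_sum_mul (μ := μ) (κ := κ)
            (a := fun i z => ENNReal.ofReal (W n i z.1 z.2 ^ 2)) (fun i => by fun_prop)
            (u := fun z => ENNReal.ofReal (f z ^ 2)) (by fun_prop)
          simp_rw [hfsq] at this
          rw [← this]
          refine lintegral_congr fun z => ?_
          rw [ENNReal.ofReal_sum_of_nonneg fun i _ => by positivity]
          exact Finset.sum_congr rfl fun i _ => (ENNReal.ofReal_mul (sq_nonneg _)).symm
      _ ≤ _ := by
          rw [← lintegral_weights_mul_sq hW hf hf1 hf0 hn]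
          gcongr with z
          -- The weighted sum is at most `1` in absolute value, so its square is bounded by its
          -- absolute value and the first moment suffices.
          rw [Real.enorm_eq_ofReal_abs, ← sq_abs, sq]
          refine ENNReal.ofReal_le_ofReal (mul_le_of_le_one_right (abs_nonneg _)
            ((Finset.abs_sum_le_sum_abs _ _).trans ?_))
          rw [← hW.sum_eq_one n hn z.1.1 fun j => (z.2 j).1]
          refine Finset.sum_le_sum fun i _ => ?_
          rw [abs_mul, abs_of_nonneg (hW.nonneg n hn _ _ _)]
          exact mul_le_of_le_one_right (hW.nonneg n hn _ _ _) (hf1 _)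
  have hfin := tendsto_measure_of_tendsto_lintegral_ofReal (fun n => sampleLaw μ n) (by
    filter_upwards [eventually_ge_atTop 1] with n hn
    exact (Measurable.iSup (hW.measurable n hn)).pow_const 2) hsq (pow_pos hη 2)
  refine tendsto_of_tendsto_of_tendsto_of_le_of_le tendsto_const_nhds hfin
    (fun _ => zero_le) fun n => measure_mono fun z hz => ?_
  exact pow_lt_pow_left₀ hz hη.le two_ne_zero

/-- Each weight is at most one. This crude bound handles the finitely many small sample sizes. -/
theorem lintegral_weights_le_nat_mul (hW : IsProbabilityWeights W) {n : ℕ} (hn : 1 ≤ n)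
    {g : Euc k → ℝ≥0∞} (hg : Measurable g) :
    ∫⁻ z, ∑ i, ENNReal.ofReal (W n i z.1 z.2) * g (z.2 i) ∂(sampleLaw μ n) ≤
      n * ∫⁻ x, g x ∂μ := by
  calc ∫⁻ z, ∑ i, ENNReal.ofReal (W n i z.1 z.2) * g (z.2 i) ∂(sampleLaw μ n)
      ≤ ∫⁻ z, ∑ i, g (z.2 i) ∂(sampleLaw μ n) := by
        refine lintegral_mono fun z => Finset.sum_le_sum fun i _ => ?_
        exact mul_le_of_le_one_left' (ENNReal.ofReal_le_one.2 (hW.le_one hn _ _ _))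
    _ = n * ∫⁻ x, g x ∂μ := by
        rw [lintegral_finsetSum _ fun i _ => by fun_prop]
        simp_rw [(measurePreserving_eval_sampleLaw μ _).lintegral_comp hg]
        simp

/-- Under consistency, the local averages of an integrable function have bounded means. -/
theorem exists_bound_lintegral_weights (hd : 1 ≤ d) (hW : IsProbabilityWeights W)
    {p : ℝ} (hp : 1 ≤ p)
    (h : ∀ (P : Measure (Euc k × Euc d)) [IsProbabilityMeasure P],
        P.fst = μ → ∫⁻ z, ‖z.2‖ₑ ^ p ∂P < ∞ →
        Tendsto (fun n : ℕ => expectedError W p P n) atTop (𝓝 0))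
    {g : Euc k → ℝ≥0∞} (hg : Measurable g) (hgi : ∫⁻ x, g x ∂μ ≠ ∞) :
    ∃ K : ℝ≥0, ∀ n : ℕ, 1 ≤ n →
      ∫⁻ z, ∑ i, ENNReal.ofReal (W n i z.1 z.2) * g (z.2 i) ∂(sampleLaw μ n) ≤ K := by
  have hp0 : 0 < p := by linarith
  obtain ⟨e, he⟩ : ∃ e : Euc d, ‖e‖ₑ = 1 :=
    ⟨EuclideanSpace.single ⟨0, hd⟩ 1, by rw [← ofReal_norm]; simp⟩
  have hae : ∀ᵐ x ∂μ, ENNReal.ofReal (g x).toReal = g x := by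
    filter_upwards [ae_lt_top hg hgi] with x hx using ENNReal.ofReal_toReal hx.ne
  -- Chosen so that `‖f‖ ^ p = g` almost everywhere.
  let f : Euc k → Euc d := fun x => (g x).toReal ^ (1 / p) • e
  have hf : Measurable f := by fun_prop
  have hfp : ∀ x, ‖f x‖ₑ ^ p = ENNReal.ofReal (g x).toReal := by
    intro x
    simp only [f]
    rw [enorm_smul, he, mul_one, Real.enorm_of_nonneg (by positivity),
      ENNReal.ofReal_rpow_of_nonneg (by positivity) hp0.le, ← Real.rpow_mul (by positivity),
      one_div_mul_cancel hp0.ne', Real.rpow_one]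
  have hfi : ∫⁻ x, ‖f x‖ₑ ^ p ∂μ = ∫⁻ x, g x ∂μ := by
    simp_rw [hfp]; exact lintegral_congr_ae hae
  have hlim := tendsto_expectedError_deterministic h hf (by rw [hfi]; exact hgi.lt_top)
  obtain ⟨N, hN⟩ := eventually_atTop.1 (ENNReal.tendsto_nhds_zero.1 hlim 1 one_pos)
  have h2 : (2 : ℝ≥0∞) ^ (p - 1) ≠ ∞ := ENNReal.rpow_ne_top_of_nonneg (by linarith) (by simp)
  -- The first two terms serve for `n ≥ N`, where the expected error is at most `1`; the last serves
  -- for `n ≤ N`.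
  have hfin : 2 ^ (p - 1) * 1 + 2 ^ (p - 1) * ∫⁻ x, g x ∂μ + N * ∫⁻ x, g x ∂μ ≠ ∞ := by
    finiteness
  obtain ⟨K, hK⟩ : ∃ K : ℝ≥0, (K : ℝ≥0∞) = _ := ⟨_, ENNReal.coe_toNNReal hfin⟩
  refine ⟨K, fun n hn => ?_⟩
  rw [hK]
  rcases le_total N n with hNn | hNn
  · have hWm := hW.measurable n hn
    have hae' : ∀ᵐ z ∂(sampleLaw μ n), ∀ i : Fin n,
        ENNReal.ofReal (g (z.2 i)).toReal = g (z.2 i) :=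
      ae_all_iff.2 fun i => (measurePreserving_eval_sampleLaw μ i).quasiMeasurePreserving.ae hae
    refine le_trans ?_ le_self_add
    calc ∫⁻ z, ∑ i, ENNReal.ofReal (W n i z.1 z.2) * g (z.2 i) ∂(sampleLaw μ n)
        = ∫⁻ z, ∑ i, ENNReal.ofReal (W n i z.1 z.2) * ‖f (z.2 i)‖ₑ ^ p ∂(sampleLaw μ n) := by
          refine lintegral_congr_ae ?_
          filter_upwards [hae'] with z hz
          simp only [hfp, hz]
      _ ≤ ∫⁻ z, 2 ^ (p - 1) * (∑ i, ENNReal.ofReal (W n i z.1 z.2) * ‖f (z.2 i) - f z.1‖ₑ ^ p)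
            + 2 ^ (p - 1) * ‖f z.1‖ₑ ^ p ∂(sampleLaw μ n) := by
          refine lintegral_mono fun z => ?_
          calc ∑ i, ENNReal.ofReal (W n i z.1 z.2) * ‖f (z.2 i)‖ₑ ^ p
              ≤ ∑ i, ENNReal.ofReal (W n i z.1 z.2) * (2 ^ (p - 1) * ‖f (z.2 i) - f z.1‖ₑ ^ p
                  + 2 ^ (p - 1) * ‖f z.1‖ₑ ^ p) := by
                gcongr with i
                have := enorm_sub_rpow_le hp (f (z.2 i) - f z.1) (-f z.1)
                rwa [sub_neg_eq_add, sub_add_cancel, enorm_neg] at this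
            _ = _ := by
                simp_rw [mul_add, Finset.sum_add_distrib]
                rw [← Finset.sum_mul, hW.sum_ofReal hn, one_mul, Finset.mul_sum]
                simp_rw [mul_left_comm]
      _ = 2 ^ (p - 1) * (∫⁻ z, ∑ i, ENNReal.ofReal (W n i z.1 z.2) * ‖f (z.2 i) - f z.1‖ₑ ^ p
            ∂(sampleLaw μ n)) + 2 ^ (p - 1) * ∫⁻ x, g x ∂μ := by
          rw [lintegral_add_left (by fun_prop), lintegral_const_mul _ (by fun_prop),
            lintegral_const_mul _ (by fun_prop), ← hfi,
            (measurePreserving_fst_sampleLaw μ n).lintegral_comp (f := fun x => ‖f x‖ₑ ^ p)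
              (by fun_prop)]
      _ ≤ _ := by
          gcongr
          exact (lintegral_weights_le_expectedError hW hp hf hn).trans (hN n hNn)
  · refine (lintegral_weights_le_nat_mul hW hn hg).trans (le_trans ?_ le_add_self)
    gcongr

/-- Consistency implies Stone's boundedness condition. -/
theorem exists_const_lintegral_weights_le (hd : 1 ≤ d) (hW : IsProbabilityWeights W)
    {p : ℝ} (hp : 1 ≤ p)
    (h : ∀ (P : Measure (Euc k × Euc d)) [IsProbabilityMeasure P],
        P.fst = μ → ∫⁻ z, ‖z.2‖ₑ ^ p ∂P < ∞ →
        Tendsto (fun n : ℕ => expectedError W p P n) atTop (𝓝 0)) :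
    ∃ C : ℝ≥0, 0 < C ∧ ∀ n : ℕ, 1 ≤ n → ∀ g : Euc k → ℝ≥0, Measurable g →
    ∫⁻ x, (g x : ℝ≥0∞) ∂μ < ∞ →
    ∫⁻ z, ∑ i, ENNReal.ofReal (W n i z.1 z.2) * (g (z.2 i) : ℝ≥0∞) ∂(sampleLaw μ n)
      ≤ (C : ℝ≥0∞) * ∫⁻ x, (g x : ℝ≥0∞) ∂μ := by
  by_contra! hcon
  choose n hn g hg hgi hlt using fun j : ℕ => hcon (4 ^ j) (by positivity)
  -- With a zero integral, the crude bound would contradict the strict inequality `hlt`.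
  have hI0 : ∀ j, ∫⁻ x, (g j x : ℝ≥0∞) ∂μ ≠ 0 := by
    intro j h0
    have := (hlt j).trans_le (lintegral_weights_le_nat_mul hW (hn j) (hg j).coe_nnreal_ennreal)
    simp [h0] at this
  -- Normalized so that `c j * g j` has integral `2⁻ʲ`: the sum `G` is integrable, yet its mean
  -- local average at sample size `n j` exceeds `4ʲ * 2⁻ʲ = 2ʲ`, which is unbounded.
  let c : ℕ → ℝ≥0∞ := fun j => 2⁻¹ ^ j * (∫⁻ x, (g j x : ℝ≥0∞) ∂μ)⁻¹
  have hcI : ∀ j, c j * ∫⁻ x, (g j x : ℝ≥0∞) ∂μ = 2⁻¹ ^ j := fun j => by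
    rw [mul_assoc, ENNReal.inv_mul_cancel (hI0 j) (hgi j).ne, mul_one]
  have hc0 : ∀ j, c j ≠ 0 := fun j => by
    refine mul_ne_zero (pow_ne_zero _ (by simp)) (ENNReal.inv_ne_zero.2 (hgi j).ne)
  have hct : ∀ j, c j ≠ ∞ := fun j =>
    ENNReal.mul_ne_top (ENNReal.pow_ne_top (by simp)) (ENNReal.inv_ne_top.2 (hI0 j))
  let G : Euc k → ℝ≥0∞ := fun x => ∑' j, c j * (g j x : ℝ≥0∞)
  have hgm : ∀ j, Measurable fun x => c j * (g j x : ℝ≥0∞) := fun j =>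
    (hg j).coe_nnreal_ennreal.const_mul _
  have hG : Measurable G := Measurable.tsum hgm
  have hGi : ∫⁻ x, G x ∂μ ≠ ∞ := by
    simp only [G]
    rw [lintegral_tsum fun j => (hgm j).aemeasurable]
    simp_rw [lintegral_const_mul _ (hg _).coe_nnreal_ennreal, hcI]
    rw [ENNReal.tsum_geometric]
    simp
  obtain ⟨K, hK⟩ := exists_bound_lintegral_weights hd hW hp h hG hGi
  obtain ⟨j, hj⟩ := pow_unbounded_of_one_lt K (one_lt_two (α := ℝ≥0))
  refine absurd (hK (n j) (hn j)) (not_le.2 ?_)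
  have hWm := hW.measurable (n j) (hn j)
  have hgj := hg j
  calc (K : ℝ≥0∞) < 2 ^ j := by exact_mod_cast hj
    _ = c j * ((4 ^ j : ℝ≥0) * ∫⁻ x, (g j x : ℝ≥0∞) ∂μ) := by
        rw [mul_left_comm, hcI, ENNReal.coe_pow, ← mul_pow]
        congr 1
        rw [show ((4 : ℝ≥0) : ℝ≥0∞) = 2 * 2 by norm_num, mul_assoc,
          ENNReal.mul_inv_cancel (by simp) (by simp), mul_one]
    _ ≤ c j * ∫⁻ z, ∑ i, ENNReal.ofReal (W (n j) i z.1 z.2) * (g j (z.2 i) : ℝ≥0∞)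
          ∂(sampleLaw μ (n j)) := by gcongr; exact (hlt j).le
    _ = ∫⁻ z, ∑ i, ENNReal.ofReal (W (n j) i z.1 z.2) * (c j * (g j (z.2 i) : ℝ≥0∞))
          ∂(sampleLaw μ (n j)) := by
        rw [← lintegral_const_mul _ (by fun_prop)]
        simp_rw [Finset.mul_sum, mul_left_comm]
    _ ≤ _ := by
        gcongr with z i
        exact ENNReal.le_tsum (f := fun j => c j * (g j (z.2 i) : ℝ≥0∞)) j

end Converse

/-- The case `d = 0` is excluded because consistency is then trivial and cannot imply anything about
the weights. -/
theorem theorem1 (k d : ℕ) (hd : 1 ≤ d) (μ : Measure (Euc k)) [IsProbabilityMeasure μ]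
    (W : LocalWeights k) (hW : IsProbabilityWeights W) :
    (StoneConditions μ W →
      ∀ p : ℝ, 1 ≤ p → ∀ (P : Measure (Euc k × Euc d)) [IsProbabilityMeasure P],
        P.fst = μ → ∫⁻ z, ‖z.2‖ₑ ^ p ∂P < ∞ →
        Tendsto (fun n : ℕ => expectedError W p P n) atTop (𝓝 0)) ∧
    (∀ p : ℝ, 1 ≤ p →
      (∀ (P : Measure (Euc k × Euc d)) [IsProbabilityMeasure P],
        P.fst = μ → ∫⁻ z, ‖z.2‖ₑ ^ p ∂P < ∞ →
        Tendsto (fun n : ℕ => expectedError W p P n) atTop (𝓝 0)) →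
      StoneConditions μ W) :=
  ⟨fun hS _ hp P _ hP hPp => tendsto_expectedError_of_stoneConditions hW hS hp P hP hPp,
    fun _ hp h => ⟨exists_const_lintegral_weights_le hd hW hp h,
      fun _ hε _ hη => tendsto_local_mass_of_tendsto_expectedError hd hW hp h hε hη,
      fun _ hη => tendsto_max_weight_of_tendsto_expectedError hd hW hp h hη⟩⟩
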